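/- All formulas and circuits below are finite. **Formulas.** A monotone DNF (resp. monotone CNF) $\varphi$ on a finite set $V$ of variables is given by a non-empty finite set of non-empty clauses, each clause being a subset of $V$, such that no clause is a subset of another one. It is read as $\bigvee_{e}\bigwedge_{x\in e}x$ (resp. $\bigwedge_{e}\bigvee_{x\in e}x$). Its size is $|\varphi| = |V|+\sum_{e}|e|$. Its hypergraph has vertex set $V$ and the clauses as hyperedges. The arity of $\varphi$ is the maximal size of a clause, its degree is the maximal number of clauses that contain a given variable, and $\mathrm{tw}(\varphi)$ is the treewidth of its hypergraph. **Circuits.** A Boolean circuit on $V$ is a directed acyclic graph whose nodes (gates) have a type among var, NOT, OR, AND, with one distinguished output gate; the var-gates have no inputs and are in bijection with $V$, and NOT-gates have exactly one input. Its size is its number of gates plus its number of wires. It is a circuit for $\varphi$ if its output gate computes the same Boolean function on $V$ as $\varphi$. It is an NNF if the inputs of NOT-gates are var-gates. Write $\mathrm{Vars}(g)$ for the set of variables with a directed path to the gate $g$. A circuit is decomposable if any two distinct inputs $g_1,g_2$ of an AND-gate satisfy $\mathrm{Vars}(g_1)\cap\mathrm{Vars}(g_2)=\emptyset$. It is deterministic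 if no two distinct inputs of an OR-gate evaluate to $1$ under the same valuation. A v-tree over $V$ is a rooted ordered binary tree (each internal node has one or two children) whose leaves are in bijection with $V$. A circuit is structured if there is a v-tree $T$ over $V$ such that, for each AND-gate with $m>0$ inputs $g_1,\dots,g_m$ (in some order), some node of $T$ has exactly $m$ children $n_1,\dots,n_m$ and each $\mathrm{Vars}(g_i)$ is included in the set of leaves of the subtree rooted at $n_i$. An SDNNF is a structured decomposable NNF, and a d-SDNNF is a deterministic SDNNF. **Statement.** For every constant $c\in\mathbb{N}$ there are constants $K\in\mathbb{N}$ and $\alpha>0$, depending only on $c$, such that for every monotone DNF (resp. monotone CNF) $\varphi$ of arity and degree at most $c$: 1. there is a d-SDNNF for $\varphi$ of size at most $|\varphi|\cdot 2^{K(\mathrm{tw}(\varphi)+1)}$; 2. every d-SDNNF (resp. SDNNF) for $\varphi$ has size at least $2^{\alpha\,\mathrm{tw}(\varphi)}$. -/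

import Mathlib

universe u

namespace KnowledgeCompilation

/-- The clauses of a minimized monotone formula (a monotone DNF or a monotone CNF) on the finite
variable set `V`; each clause is identified with the set of its variables.  The same data is the
hypergraph of the formula: the vertices are the variables, the hyperedges are the clauses. -/
structure MonotoneFormula (V : Type u) where
  clauses : Finset (Finset V)
  clauses_nonempty : clauses.Nonempty
  clause_nonempty : ∀ e ∈ clauses, e.Nonempty
  minimized : ∀ e ∈ clauses, ∀ e' ∈ clauses, e ⊆ e' → e = e'

namespace MonotoneFormula

variable {V : Type u}

/-- Value of the formula read as a DNF: a disjunction of conjunctions of variables. -/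
def DNFTrue (φ : MonotoneFormula V) (ν : V → Bool) : Prop :=
  ∃ e ∈ φ.clauses, ∀ x ∈ e, ν x = true

/-- Value of the formula read as a CNF: a conjunction of disjunctions of variables. -/
def CNFTrue (φ : MonotoneFormula V) (ν : V → Bool) : Prop :=
  ∀ e ∈ φ.clauses, ∃ x ∈ e, ν x = true

/-- The size `|φ|`: the number of variables plus the number of variable occurrences. -/
def size [Fintype V] (φ : MonotoneFormula V) : ℕ :=
  Fintype.card V + ∑ e ∈ φ.clauses, e.card

/-- The maximal size of a clause. -/
def arity (φ : MonotoneFormula V) : ℕ :=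
  φ.clauses.sup Finset.card

open Classical in
/-- The maximal number of clauses to which a variable belongs. -/
noncomputable def degree [Fintype V] (φ : MonotoneFormula V) : ℕ :=
  Finset.univ.sup fun v : V => (φ.clauses.filter fun e => v ∈ e).card

end MonotoneFormula

/-- Tree decompositions of the hypergraph of `φ`.  (A finite tree can be rooted at any of its
nodes; the choice of a root does not affect the width.)  A variable that occurs in no clause is
allowed to occur in no bag, hence `Preconnected` in the last condition. -/
structure TreeDecomposition {V : Type u} (φ : MonotoneFormula V) where
  Node : Type u
  [fintypeNode : Fintype Node]
  tree : SimpleGraph Node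
  isTree : tree.IsTree
  bag : Node → Finset V
  covers : ∀ e ∈ φ.clauses, ∃ b, e ⊆ bag b
  connected : ∀ v : V, (tree.induce {b | v ∈ bag b}).Preconnected

attribute [instance] TreeDecomposition.fintypeNode

/-- The width: maximal size of a bag, minus one.  (Some bag is nonempty, since `φ` has a
nonempty clause.) -/
def TreeDecomposition.width {V : Type u} {φ : MonotoneFormula V} (D : TreeDecomposition φ) : ℕ :=
  (Finset.univ.sup fun b => (D.bag b).card) - 1

/-- The treewidth: minimal width of a tree decomposition. -/
noncomputable def MonotoneFormula.treewidth {V : Type u} (φ : MonotoneFormula V) : ℕ :=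
  sInf {k | ∃ D : TreeDecomposition φ, D.width = k}

/-- The type of a gate; a variable gate carries the variable that it stands for. -/
inductive GateKind (V : Type u) where
  | var (x : V)
  | not
  | or
  | and

/-- Boolean circuits whose set of variable gates is (in bijection with) `V`.  `wire g' g` says that
`g'` is an input of `g`. -/
structure Circuit (V : Type u) where
  Gate : Type u
  [finiteGate : Finite Gate]
  kind : Gate → GateKind V
  wire : Gate → Gate → Prop
  output : Gate
  acyclic : ∀ g, ¬ Relation.TransGen wire g g
  var_unique : ∀ x, ∃! g, kind g = GateKind.var x
  var_fanIn : ∀ g x, kind g = GateKind.var x → ∀ g', ¬ wire g' g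
  not_fanIn : ∀ g, kind g = GateKind.not → ∃! g', wire g' g

attribute [instance] Circuit.finiteGate

/-- Rooted ordered binary trees with leaves labeled in `V`; internal nodes have one or two
children. -/
inductive VTree (V : Type u) where
  | leaf (x : V)
  | unary (t : VTree V)
  | binary (l r : VTree V)

namespace VTree

variable {V : Type u}

/-- The list of leaf labels. -/
def leaves : VTree V → List V
  | leaf x => [x]
  | unary t => t.leaves
  | binary l r => l.leaves ++ r.leaves

/-- The children of the root, given as the subtrees rooted at them. -/
def children : VTree V → List (VTree V)
  | leaf _ => []
  | unary t => [t]
  | binary l r => [l, r]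

/-- All nodes of the tree, given as the subtrees rooted at them. -/
def nodes : VTree V → List (VTree V)
  | leaf x => [leaf x]
  | unary t => unary t :: t.nodes
  | binary l r => binary l r :: (l.nodes ++ r.nodes)

/-- `T` is a v-tree over `V`: its leaves are in bijection with `V`. -/
def IsOver (T : VTree V) : Prop :=
  T.leaves.Nodup ∧ ∀ x : V, x ∈ T.leaves

end VTree

namespace Circuit

variable {V : Type u} (C : Circuit V)

theorem wire_wellFounded : WellFounded C.wire := by
  have : Std.Irrefl (Relation.TransGen C.wire) := ⟨C.acyclic⟩
  have h : WellFounded (Relation.TransGen C.wire) :=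
    Finite.wellFounded_of_trans_of_irrefl _
  exact Subrelation.wf (fun hab => Relation.TransGen.single hab) h

open Classical in
/-- The evaluation of all gates under a valuation of the variables. -/
noncomputable def eval (ν : V → Bool) : C.Gate → Bool :=
  C.wire_wellFounded.fix fun g rec =>
    match C.kind g with
    | GateKind.var x => ν x
    | GateKind.not => decide (∃ g', ∃ h : C.wire g' g, rec g' h = false)
    | GateKind.or => decide (∃ g', ∃ h : C.wire g' g, rec g' h = true)
    | GateKind.and => decide (∀ g', ∀ h : C.wire g' g, rec g' h = true)

open Classical in
theorem eval_eq (ν : V → Bool) (g : C.Gate) :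
    C.eval ν g =
      match C.kind g with
      | GateKind.var x => ν x
      | GateKind.not => decide (∃ g', C.wire g' g ∧ C.eval ν g' = false)
      | GateKind.or => decide (∃ g', C.wire g' g ∧ C.eval ν g' = true)
      | GateKind.and => decide (∀ g', C.wire g' g → C.eval ν g' = true) := by
  rw [eval, WellFounded.fix_eq]
  cases C.kind g <;> simp

/-- The circuit captures the given Boolean function on `V`. -/
def Captures (f : (V → Bool) → Prop) : Prop :=
  ∀ ν, C.eval ν C.output = true ↔ f ν

/-- The size of the underlying graph: number of gates plus number of wires. -/
noncomputable def size : ℕ :=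
  Nat.card C.Gate + Nat.card {p : C.Gate × C.Gate // C.wire p.1 p.2}

/-- Negation normal form: the inputs of NOT-gates are variable gates. -/
def IsNNF : Prop :=
  ∀ g, C.kind g = GateKind.not → ∀ g', C.wire g' g → ∃ x, C.kind g' = GateKind.var x

/-- The variables whose gate has a directed path to `g`. -/
def vars (g : C.Gate) : Set V :=
  {x | ∃ g', C.kind g' = GateKind.var x ∧ Relation.ReflTransGen C.wire g' g}

/-- Every AND-gate has inputs with pairwise disjoint sets of variables. -/
def IsDecomposable : Prop :=
  ∀ g, C.kind g = GateKind.and → ∀ g₁ g₂, C.wire g₁ g → C.wire g₂ g → g₁ ≠ g₂ →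
    Disjoint (C.vars g₁) (C.vars g₂)

/-- No two distinct inputs of an OR-gate evaluate to `1` under the same valuation. -/
def IsDeterministic : Prop :=
  ∀ g, C.kind g = GateKind.or → ∀ g₁ g₂, C.wire g₁ g → C.wire g₂ g → g₁ ≠ g₂ →
    ∀ ν, ¬ (C.eval ν g₁ = true ∧ C.eval ν g₂ = true)

/-- The node `n` structures the gate `g`: for some enumeration `g₁, …, gₘ` of the inputs of `g`,
the node has exactly `m` children `n₁, …, nₘ`, and the variables of `gᵢ` are among the leaves
below `nᵢ`. -/
def StructuresGate (n : VTree V) (g : C.Gate) : Prop :=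
  ∃ inputs : List C.Gate, inputs.Nodup ∧ (∀ g', g' ∈ inputs ↔ C.wire g' g) ∧
    List.Forall₂ (fun g' t => ∀ x ∈ C.vars g', x ∈ t.leaves) inputs n.children

/-- The v-tree `T` structures the circuit. -/
def IsStructuredBy (T : VTree V) : Prop :=
  T.IsOver ∧ ∀ g, C.kind g = GateKind.and → (∃ g', C.wire g' g) →
    ∃ n ∈ T.nodes, C.StructuresGate n g

/-- Structured (decomposable) NNFs. -/
def IsSDNNF : Prop :=
  C.IsNNF ∧ C.IsDecomposable ∧ ∃ T : VTree V, C.IsStructuredBy T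

/-- Deterministic structured decomposable NNFs. -/
def IsDSDNNF : Prop :=
  C.IsSDNNF ∧ C.IsDeterministic

end Circuit

end KnowledgeCompilation

/-! Treewidth is compared with cuts of v-trees. A clause crosses a set `A` of variables if it has
variables inside and outside of `A`. For bounded arity and degree, the treewidth agrees, up to
affine bounds, with the least `M` such that some v-tree has at most `M` crossing clauses at the leaf
set of each node: `exists_vtree` turns tree decompositions into v-trees, `treewidth_le_of_vtree`
goes back.

Upper bound. If `M` clauses cross `A`, a valuation of `A` influences the formula only through one
bit per crossing clause and one bit for all clauses inside `A`. So there are at most `2 ^ (M + 1)`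
subfunctions at each node. The circuit that computes bottom-up which of them occurs (`stateCircuit`)
follows the v-tree, and it is deterministic because every node has exactly one state.

Lower bound. The v-tree of a given circuit has a node crossed by many clauses, and a constant
fraction of these, say `m`, are pairwise far apart. Fixing the other variables turns the DNF into
the disjunction of `x e ∧ y e`, with `x e` and `y e` on different sides of the cut: this is set
intersection on `m` points (`exists_hard_cut`). The CNF becomes set disjointness by duality. At a
cut, each gate lies on one side, or is an OR, or is one input conjoined with something that ignores
`A` (`cutCase`). Hence, with `s` gates, `s + 1` predicates on the `A` side suffice to certify
acceptance, and the `2 ^ m` pairs of a set and its complement need distinct certificates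
(`pow_le_of_fooling`). Set intersection has a cover by `m` rectangles, so DNFs need determinism: ORs
become sums of indicators, the restricted functions span dimension at most `s + 1`, and the
inclusion matrix has full rank (`pow_le_of_rank`). -/

namespace KnowledgeCompilation

/-! ### Rooted trees given by a parent map -/

section RootedTrees

variable {N : Type*} {r : N} {par : N → N} {d : N → ℕ}

/-- Climbing from any `s` stays in `S` and strictly decreases `d`, so it must stop, and it can only
stop at `s₀`. -/
theorem reachable_induce_of_parent_closed (hd : ∀ n, n ≠ r → d (par n) < d n)
    {G : SimpleGraph N} (hG : ∀ n, n ≠ r → G.Adj n (par n)) {S : Set N} {s₀ : N} (hs₀ : s₀ ∈ S)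
    (hS : ∀ s ∈ S, s ≠ s₀ → s ≠ r ∧ par s ∈ S) (s : N) (hs : s ∈ S) :
    (G.induce S).Reachable ⟨s, hs⟩ ⟨s₀, hs₀⟩ := by
  induction h : d s using Nat.strong_induction_on generalizing s with
  | _ k ih =>
    by_cases hss : s = s₀
    · subst hss; exact SimpleGraph.Reachable.refl _
    · obtain ⟨hr, hp⟩ := hS s hs hss
      refine SimpleGraph.Reachable.trans (SimpleGraph.Adj.reachable ?_)
        (ih (d (par s)) (h ▸ hd s hr) (par s) hp rfl)
      exact hG s hr

/-- Climbing to the root gives connectedness. The map sending `n ≠ r` to its edge to `par n` is onto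
the edges, so there are fewer edges than nodes, and a connected graph with that few edges is a tree.
-/
theorem isTree_of_parent [Finite N] (hd : ∀ n, n ≠ r → d (par n) < d n) {G : SimpleGraph N}
    (hG : ∀ a b, G.Adj a b ↔ (a ≠ r ∧ par a = b) ∨ (b ≠ r ∧ par b = a)) : G.IsTree := by
  classical
  have hadj : ∀ n, n ≠ r → G.Adj n (par n) := fun n hn => (hG _ _).2 (Or.inl ⟨hn, rfl⟩)
  have hreach : ∀ n, G.Reachable n r := by
    intro n
    have := reachable_induce_of_parent_closed hd hadj (S := Set.univ) (s₀ := r) (Set.mem_univ _)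
      (fun s _ h => ⟨h, Set.mem_univ _⟩) n (Set.mem_univ _)
    exact this.map (SimpleGraph.Embedding.induce _).toHom
  have hconn : G.Connected :=
    { preconnected := fun a b => (hreach a).trans (hreach b).symm
      nonempty := ⟨r⟩ }
  rw [SimpleGraph.isTree_iff_connected_and_card]
  refine ⟨hconn, le_antisymm ?_ hconn.card_vert_le_card_edgeSet_add_one⟩
  have hsurj : Function.Surjective
      (fun n : {n : N // n ≠ r} => (⟨s(n.1, par n.1), hadj n.1 n.2⟩ : G.edgeSet)) := by
    rintro ⟨e, he⟩
    induction e with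
    | _ a b =>
      rcases (hG a b).1 he with ⟨h, h'⟩ | ⟨h, h'⟩
      · exact ⟨⟨a, h⟩, by simp [h']⟩
      · exact ⟨⟨b, h⟩, by simp [h', Sym2.eq_swap]⟩
  have h1 : Nat.card G.edgeSet ≤ _ := Nat.card_le_card_of_surjective _ hsurj
  have h2 : Nat.card {n : N // n ≠ r} < Nat.card N := by
    have := Fintype.ofFinite N
    rw [Nat.card_eq_fintype_card, Nat.card_eq_fintype_card]
    exact Fintype.card_subtype_lt (x := r) (by simp)
  omega

/-- The parent of `n` is the penultimate vertex of the unique path from `r` to `n`, and `d` is the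
length of that path. The convention `par r = r` makes `par` total, which is why children are later
required to differ from their parent. -/
theorem exists_parent_of_isTree {G : SimpleGraph N} (hG : G.IsTree) (r : N) :
    ∃ (par : N → N) (d : N → ℕ), par r = r ∧ (∀ n, n ≠ r → d (par n) < d n) ∧
      ∀ a b, G.Adj a b → par a = b ∨ par b = a := by
  classical
  choose p hp using fun n => (hG.existsUnique_path r n).exists
  have huniq : ∀ n (q : G.Walk r n), q.IsPath → q = p n := fun n q hq =>
    (hG.existsUnique_path r n).unique hq (hp n)
  refine ⟨fun n => (p n).penultimate, fun n => (p n).length, ?_, ?_, ?_⟩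
  · change (p r).penultimate = r
    rw [← huniq r .nil SimpleGraph.Walk.IsPath.nil]; rfl
  · intro n hn
    have h := huniq _ (p n).dropLast (hp n).dropLast
    have hnil : ¬ (p n).Nil := fun h => hn h.eq.symm
    have h1 : (p n).length ≠ 0 := fun h => hnil (SimpleGraph.Walk.length_eq_zero_iff.1 h)
    change (p (p n).penultimate).length < (p n).length
    rw [← h]
    have := SimpleGraph.Walk.length_dropLast_add_one hnil
    omega
  · intro a b hab
    by_cases hb : b ∈ (p a).support
    · left
      exact (hG.isAcyclic.eq_penultimate_of_adj_end (hp a) hab hb).symm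
    · right
      have := hG.isAcyclic.mem_support_of_ne_mem_support_of_adj_of_isPath (hp b) (hp a) hab.symm hb
      exact (hG.isAcyclic.eq_penultimate_of_adj_end (hp b) hab.symm this).symm

/-- `Below par c m`: the node `c` is reached from `m` by iterating the parent map. -/
def Below (par : N → N) (c m : N) : Prop :=
  ∃ i : ℕ, par^[i] m = c

theorem Below.refl (c : N) : Below par c c := ⟨0, rfl⟩

theorem Below.of_parent {c m : N} (h : Below par c (par m)) : Below par c m := by
  obtain ⟨i, hi⟩ := h
  exact ⟨i + 1, by simpa using hi⟩

theorem Below.parent {c m : N} (h : Below par c m) : Below par (par c) m := by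
  obtain ⟨i, hi⟩ := h
  exact ⟨i + 1, by rw [Function.iterate_succ_apply', hi]⟩

theorem Below.eq_or_parent {c m : N} (h : Below par c m) : m = c ∨ Below par c (par m) := by
  obtain ⟨i, hi⟩ := h
  cases i with
  | zero => exact Or.inl hi
  | succ i => exact Or.inr ⟨i, by simpa using hi⟩

theorem Below.eq_or_child {n m : N} (h : Below par n m) :
    m = n ∨ ∃ c, c ≠ n ∧ par c = n ∧ Below par c m := by
  classical
  by_cases hm : m = n
  · exact Or.inl hm
  · right
    have hi := Nat.find_spec h
    cases hf : Nat.find h with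
    | zero => rw [hf] at hi; exact absurd hi hm
    | succ i =>
      rw [hf, Function.iterate_succ_apply'] at hi
      exact ⟨par^[i] m, Nat.find_min h (by omega), hi, i, rfl⟩

theorem depth_le_of_below (hr : par r = r) (hd : ∀ n, n ≠ r → d (par n) < d n) {c m : N}
    (h : Below par c m) : d c ≤ d m := by
  obtain ⟨i, hi⟩ := h
  induction i generalizing m with
  | zero => exact hi ▸ le_rfl
  | succ i ih =>
    have := ih hi
    by_cases hm : m = r
    · subst hm; rwa [hr] at this
    · exact this.trans (hd m hm).le

theorem below_root (hd : ∀ n, n ≠ r → d (par n) < d n) (m : N) : Below par r m := by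
  induction h : d m using Nat.strong_induction_on generalizing m with
  | _ k ih =>
    by_cases hm : m = r
    · exact hm ▸ Below.refl _
    · exact (ih _ (h ▸ hd m hm) (par m) rfl).of_parent

theorem below_of_below {c c' m : N} (h : Below par c m) (h' : Below par c' m) :
    Below par c c' ∨ Below par c' c := by
  obtain ⟨i, hi⟩ := h
  obtain ⟨j, hj⟩ := h'
  rcases le_total i j with hij | hij
  · right
    refine ⟨j - i, ?_⟩
    rw [← hi, ← Function.iterate_add_apply, Nat.sub_add_cancel hij, hj]
  · left
    refine ⟨i - j, ?_⟩
    rw [← hj, ← Function.iterate_add_apply, Nat.sub_add_cancel hij, hi]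

/-- Two ancestors of `m` are comparable. If one child of `n` were strictly below another one, then
`n` itself would be below the latter, against the depths. -/
theorem child_eq_of_below (hr : par r = r) (hd : ∀ n, n ≠ r → d (par n) < d n) {n c c' m : N}
    (hc : c ≠ n) (hc' : c' ≠ n) (hcn : par c = n) (hcn' : par c' = n)
    (h : Below par c m) (h' : Below par c' m) : c = c' := by
  have key : ∀ {a b : N}, a ≠ n → b ≠ n → par a = n → par b = n → Below par a b → b = a := by
    intro a b ha hb han hbn hab
    rcases hab.eq_or_parent with h | h
    · exact h
    · exfalso
      rw [hbn] at h
      have h1 := depth_le_of_below hr hd h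
      have har : a ≠ r := by rintro rfl; exact ha (hr.symm.trans han)
      have h2 := hd a har
      rw [han] at h2
      omega
  rcases below_of_below h h' with h | h
  · exact (key hc hc' hcn hcn' h).symm
  · exact key hc' hc hcn' hcn h

/-- A connected set of nodes that meets a branch and its complement contains both ends of the edge
that separates them. -/
theorem mem_of_preconnected_of_below {G : SimpleGraph N}
    (hG : ∀ a b, G.Adj a b → par a = b ∨ par b = a) {S : Set N} (hS : (G.induce S).Preconnected)
    {c a b : N} (ha : a ∈ S) (hb : b ∈ S) (hca : Below par c a) (hcb : ¬ Below par c b) :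
    par c ∈ S := by
  obtain ⟨p⟩ := hS ⟨a, ha⟩ ⟨b, hb⟩
  obtain ⟨e, -, he1, he2⟩ := p.exists_boundary_dart {m | Below par c m.1} hca hcb
  have hadj : G.Adj e.fst.1 e.snd.1 := e.adj
  rcases hG _ _ hadj with h | h
  · rcases Below.eq_or_parent he1 with h' | h'
    · rw [← h', h]; exact e.snd.2
    · rw [h] at h'; exact absurd h' he2
  · exact absurd (Below.of_parent (h ▸ he1)) he2

end RootedTrees

/-! ### V-trees -/

namespace VTree

variable {V : Type u}

theorem leaves_ne_nil (t : VTree V) : t.leaves ≠ [] := by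
  induction t with
  | leaf x => simp [leaves]
  | unary t ih => simpa [leaves] using ih
  | binary l r ihl ihr => simp [leaves, ihl]

theorem exists_mem_leaves (t : VTree V) : ∃ x, x ∈ t.leaves :=
  List.exists_mem_of_ne_nil _ t.leaves_ne_nil

theorem self_mem_nodes (t : VTree V) : t ∈ t.nodes := by
  cases t <;> simp [nodes]

theorem mem_nodes_iff {t n : VTree V} : n ∈ t.nodes ↔ n = t ∨ ∃ c ∈ t.children, n ∈ c.nodes := by
  cases t <;> simp [nodes, children]

theorem children_subset_nodes {t c : VTree V} (h : c ∈ t.children) : c ∈ t.nodes :=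
  mem_nodes_iff.2 (Or.inr ⟨c, h, c.self_mem_nodes⟩)

theorem leaves_subset_of_mem_children {t c : VTree V} (h : c ∈ t.children) :
    c.leaves ⊆ t.leaves := by
  cases t with
  | leaf x => simp [children] at h
  | unary t => simp only [children, List.mem_singleton] at h; subst h; simp [leaves]
  | binary l r =>
    simp only [children, List.mem_cons, List.not_mem_nil, or_false] at h
    rcases h with rfl | rfl <;> simp [leaves]

theorem sizeOf_lt_of_mem_children {t c : VTree V} (h : c ∈ t.children) :
    sizeOf c < sizeOf t := by
  cases t with
  | leaf x => simp [children] at h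
  | unary t => simp only [children, List.mem_singleton] at h; subst h; simp
  | binary l r =>
    simp only [children, List.mem_cons, List.not_mem_nil, or_false] at h
    rcases h with rfl | rfl
    · simp; omega
    · simp

theorem nodes_trans {t n m : VTree V} (hn : n ∈ t.nodes) (hm : m ∈ n.nodes) : m ∈ t.nodes := by
  induction t with
  | leaf x =>
    simp only [nodes, List.mem_singleton] at hn; subst hn; exact hm
  | unary t ih =>
    simp only [nodes, List.mem_cons] at hn
    rcases hn with rfl | hn
    · exact hm
    · exact List.mem_cons_of_mem _ (ih hn)
  | binary l r ihl ihr =>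
    simp only [nodes, List.mem_cons, List.mem_append] at hn
    rcases hn with rfl | hn | hn
    · exact hm
    · exact List.mem_cons_of_mem _ (List.mem_append_left _ (ihl hn))
    · exact List.mem_cons_of_mem _ (List.mem_append_right _ (ihr hn))

theorem leaves_subset_of_mem_nodes {t n : VTree V} (hn : n ∈ t.nodes) : n.leaves ⊆ t.leaves := by
  induction t with
  | leaf x =>
    simp only [nodes, List.mem_singleton] at hn; subst hn; simp
  | unary t ih =>
    simp only [nodes, List.mem_cons] at hn
    rcases hn with rfl | hn
    · simp
    · exact ih hn
  | binary l r ihl ihr =>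
    simp only [nodes, List.mem_cons, List.mem_append] at hn
    rcases hn with rfl | hn | hn
    · simp
    · exact fun x hx => by simp [leaves, ihl hn hx]
    · exact fun x hx => by simp [leaves, ihr hn hx]

theorem nodup_of_mem_nodes {t n : VTree V} (ht : t.leaves.Nodup) (hn : n ∈ t.nodes) :
    n.leaves.Nodup := by
  induction t with
  | leaf x =>
    simp only [nodes, List.mem_singleton] at hn; subst hn; simp [leaves]
  | unary t ih =>
    simp only [nodes, List.mem_cons] at hn
    rcases hn with rfl | hn
    · exact ht
    · exact ih ht hn
  | binary l r ihl ihr =>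
    simp only [nodes, List.mem_cons, List.mem_append] at hn
    rcases hn with rfl | hn | hn
    · exact ht
    · exact ihl (List.Nodup.of_append_left ht) hn
    · exact ihr (List.Nodup.of_append_right ht) hn

theorem leaf_mem_nodes {t : VTree V} {x : V} (hx : x ∈ t.leaves) : leaf x ∈ t.nodes := by
  induction t with
  | leaf y => simp only [leaves, List.mem_singleton] at hx; subst hx; simp [nodes]
  | unary t ih => exact List.mem_cons_of_mem _ (ih hx)
  | binary l r ihl ihr =>
    simp only [leaves, List.mem_append] at hx
    rcases hx with hx | hx
    · exact List.mem_cons_of_mem _ (List.mem_append_left _ (ihl hx))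
    · exact List.mem_cons_of_mem _ (List.mem_append_right _ (ihr hx))

/-- The sets of leaves of the nodes of a v-tree form a laminar family. -/
theorem mem_nodes_or_mem_nodes {t n m : VTree V} (ht : t.leaves.Nodup) (hn : n ∈ t.nodes)
    (hm : m ∈ t.nodes) {x : V} (hxn : x ∈ n.leaves) (hxm : x ∈ m.leaves) :
    n ∈ m.nodes ∨ m ∈ n.nodes := by
  induction t with
  | leaf y =>
    simp only [nodes, List.mem_singleton] at hn hm
    subst hn; subst hm; exact Or.inl (self_mem_nodes _)
  | unary t ih =>
    rw [nodes, List.mem_cons] at hn hm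
    rcases hn with rfl | hn
    · exact Or.inr (List.mem_cons.2 hm)
    rcases hm with rfl | hm
    · exact Or.inl (List.mem_cons_of_mem _ hn)
    exact ih ht hn hm
  | binary l r ihl ihr =>
    rw [nodes, List.mem_cons] at hn hm
    rcases hn with rfl | hn
    · exact Or.inr (List.mem_cons.2 hm)
    rcases hm with rfl | hm
    · exact Or.inl (List.mem_cons_of_mem _ hn)
    rw [leaves, List.nodup_append'] at ht
    rw [List.mem_append] at hn hm
    rcases hn with hn | hn <;> rcases hm with hm | hm
    · exact ihl ht.1 hn hm
    · exact (ht.2.2 (leaves_subset_of_mem_nodes hn hxn)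
        (leaves_subset_of_mem_nodes hm hxm)).elim
    · exact (ht.2.2 (leaves_subset_of_mem_nodes hm hxm)
        (leaves_subset_of_mem_nodes hn hxn)).elim
    · exact ihr ht.2.1 hn hm

theorem exists_parent {t n : VTree V} (hn : n ∈ t.nodes) (h : n ≠ t) :
    ∃ p ∈ t.nodes, n ∈ p.children := by
  induction t with
  | leaf x => simp only [nodes, List.mem_singleton] at hn; exact (h hn).elim
  | unary t ih =>
    simp only [nodes, List.mem_cons] at hn
    rcases hn with rfl | hn
    · exact (h rfl).elim
    by_cases hnt : n = t
    · exact ⟨_, self_mem_nodes _, by simp [children, hnt]⟩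
    · obtain ⟨p, hp, hc⟩ := ih hn hnt
      exact ⟨p, List.mem_cons_of_mem _ hp, hc⟩
  | binary l r ihl ihr =>
    simp only [nodes, List.mem_cons, List.mem_append] at hn
    rcases hn with rfl | hn | hn
    · exact (h rfl).elim
    · by_cases hnt : n = l
      · exact ⟨_, self_mem_nodes _, by simp [children, hnt]⟩
      · obtain ⟨p, hp, hc⟩ := ihl hn hnt
        exact ⟨p, List.mem_cons_of_mem _ (List.mem_append_left _ hp), hc⟩
    · by_cases hnt : n = r
      · exact ⟨_, self_mem_nodes _, by simp [children, hnt]⟩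
      · obtain ⟨p, hp, hc⟩ := ihr hn hnt
        exact ⟨p, List.mem_cons_of_mem _ (List.mem_append_right _ hp), hc⟩

theorem exists_child_of_mem_nodes {n m : VTree V} (h : n ∈ m.nodes) (hne : n ≠ m) :
    ∃ c ∈ m.children, n ∈ c.nodes :=
  (mem_nodes_iff.1 h).resolve_left hne

open Classical in
/-- The set of leaves. -/
noncomputable def leafSet (t : VTree V) : Finset V :=
  t.leaves.toFinset

@[simp]
theorem mem_leafSet {t : VTree V} {x : V} : x ∈ t.leafSet ↔ x ∈ t.leaves := by
  simp [leafSet]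

/-- Every internal node has two children. -/
def IsFull : VTree V → Prop
  | leaf _ => True
  | unary _ => False
  | binary l r => l.IsFull ∧ r.IsFull

/-- Unary chains would make the number of nodes unbounded; fullness keeps the circuit of the upper
bound linear in the number of variables. -/
theorem IsFull.length_nodes {t : VTree V} (h : t.IsFull) :
    t.nodes.length + 1 = 2 * t.leaves.length := by
  induction t with
  | leaf x => simp [nodes, leaves]
  | unary t ih => exact h.elim
  | binary l r ihl ihr =>
    have := ihl h.1
    have := ihr h.2
    simp only [nodes, leaves, List.length_cons, List.length_append]
    omega

theorem IsFull.of_mem_nodes {t n : VTree V} (h : t.IsFull) (hn : n ∈ t.nodes) : n.IsFull := by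
  induction t with
  | leaf x => simp only [nodes, List.mem_singleton] at hn; subst hn; trivial
  | unary t ih => exact h.elim
  | binary l r ihl ihr =>
    simp only [nodes, List.mem_cons, List.mem_append] at hn
    rcases hn with rfl | hn | hn
    · exact h
    · exact ihl h.1 hn
    · exact ihr h.2 hn

end VTree

/-! ### Crossing clauses and elementary bounds on the treewidth -/

namespace MonotoneFormula

variable {V : Type u}

open Classical in
/-- The clauses that have a variable in `A` and a variable outside of `A`. -/
noncomputable def crossing (φ : MonotoneFormula V) (A : Finset V) : Finset (Finset V) :=
  φ.clauses.filter fun e => (∃ x ∈ e, x ∈ A) ∧ ∃ y ∈ e, y ∉ A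

theorem mem_crossing {φ : MonotoneFormula V} {A : Finset V} {e : Finset V} :
    e ∈ φ.crossing A ↔ e ∈ φ.clauses ∧ (∃ x ∈ e, x ∈ A) ∧ ∃ y ∈ e, y ∉ A := by
  simp [crossing]

theorem card_le_arity {φ : MonotoneFormula V} {e : Finset V} (he : e ∈ φ.clauses) :
    e.card ≤ φ.arity :=
  Finset.le_sup (f := Finset.card) he

open Classical in
theorem card_filter_mem_le_degree [Fintype V] (φ : MonotoneFormula V) (v : V) :
    (φ.clauses.filter fun e => v ∈ e).card ≤ φ.degree :=
  Finset.le_sup (f := fun v : V => (φ.clauses.filter fun e => v ∈ e).card) (Finset.mem_univ v)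

open Classical in
/-- The clauses that meet a set of variables. -/
theorem card_filter_meet_le [Fintype V] (φ : MonotoneFormula V) (B : Finset V) :
    (φ.clauses.filter fun e => ∃ x ∈ e, x ∈ B).card ≤ B.card * φ.degree := by
  have : (φ.clauses.filter fun e => ∃ x ∈ e, x ∈ B) ⊆
      B.biUnion fun v => φ.clauses.filter fun e => v ∈ e := by
    intro e
    simp only [Finset.mem_filter, Finset.mem_biUnion]
    rintro ⟨he, x, hx, hB⟩
    exact ⟨x, hB, he, hx⟩
  exact (Finset.card_le_card this).trans
    (Finset.card_biUnion_le_card_mul _ _ _ fun v _ => φ.card_filter_mem_le_degree v)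

theorem nonempty_vars (φ : MonotoneFormula V) : Nonempty V := by
  obtain ⟨e, he⟩ := φ.clauses_nonempty
  obtain ⟨x, -⟩ := φ.clause_nonempty e he
  exact ⟨x⟩

end MonotoneFormula

theorem treewidth_le {V : Type u} {φ : MonotoneFormula V} (D : TreeDecomposition φ) :
    φ.treewidth ≤ D.width :=
  Nat.sInf_le ⟨D, rfl⟩

/-- The tree decomposition with a single bag. -/
def TreeDecomposition.single {V : Type u} [Fintype V] (φ : MonotoneFormula V) :
    TreeDecomposition φ where
  Node := PUnit
  tree := ⊥
  isTree := SimpleGraph.IsTree.of_subsingleton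
  bag _ := Finset.univ
  covers _ _ := ⟨PUnit.unit, Finset.subset_univ _⟩
  connected _ := SimpleGraph.Preconnected.of_subsingleton

theorem exists_width_eq_treewidth {V : Type u} [Fintype V] (φ : MonotoneFormula V) :
    ∃ D : TreeDecomposition φ, D.width = φ.treewidth :=
  Nat.sInf_mem (s := {k | ∃ D : TreeDecomposition φ, D.width = k})
    ⟨_, TreeDecomposition.single φ, rfl⟩

theorem treewidth_lt_card {V : Type u} [Fintype V] (φ : MonotoneFormula V) :
    φ.treewidth < Fintype.card V := by
  have h := treewidth_le (TreeDecomposition.single φ)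
  have hpos : 0 < Fintype.card V := Fintype.card_pos_iff.2 φ.nonempty_vars
  have h2 : (TreeDecomposition.single φ).width ≤ Fintype.card V - 1 := by
    refine Nat.sub_le_sub_right (Finset.sup_le fun b _ => ?_) 1
    exact Finset.card_le_univ _
  omega

/-! ### From v-trees to tree decompositions -/

namespace VTree

variable {V : Type u}

open Classical in
/-- The clauses that meet the leaves of `t` but are not covered by one child of `t`. -/
noncomputable def alive (φ : MonotoneFormula V) (t : VTree V) : Finset (Finset V) :=
  φ.clauses.filter fun e => (∃ x ∈ e, x ∈ t.leaves) ∧ ∀ c ∈ t.children, ¬ ∀ x ∈ e, x ∈ c.leaves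

theorem mem_alive {φ : MonotoneFormula V} {t : VTree V} {e : Finset V} :
    e ∈ t.alive φ ↔ e ∈ φ.clauses ∧ (∃ x ∈ e, x ∈ t.leaves) ∧
      ∀ c ∈ t.children, ¬ ∀ x ∈ e, x ∈ c.leaves := by
  simp [alive]

/-- At a binary node, an alive clause either crosses the node, or is contained in its leaves without
fitting in one child, and then it crosses the left child. At a leaf there are at most `φ.degree`
clauses. -/
theorem card_alive_le [Fintype V] (φ : MonotoneFormula V) {T t : VTree V} {M : ℕ}
    (hM : ∀ n ∈ T.nodes, (φ.crossing n.leafSet).card ≤ M) (ht : t ∈ T.nodes) :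
    (t.alive φ).card ≤ 2 * M + φ.degree := by
  classical
  cases t with
  | leaf x =>
    refine (Finset.card_le_card ?_).trans
      ((φ.card_filter_mem_le_degree x).trans (Nat.le_add_left _ _))
    intro e he
    rw [mem_alive] at he
    obtain ⟨he, ⟨y, hy, hyx⟩, -⟩ := he
    simp only [leaves, List.mem_singleton] at hyx
    subst hyx
    exact Finset.mem_filter.2 ⟨he, hy⟩
  | unary t =>
    have hsub : (unary t).alive φ ⊆ φ.crossing (unary t).leafSet := by
      intro e he
      rw [mem_alive] at he
      obtain ⟨he, ⟨y, hy, hyx⟩, h⟩ := he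
      have := h t (by simp [children])
      push Not at this
      exact MonotoneFormula.mem_crossing.2 ⟨he, ⟨y, hy, by simpa using hyx⟩, by simpa [leaves]⟩
    have := Finset.card_le_card hsub
    have := hM _ ht
    omega
  | binary l r =>
    have hl : l ∈ T.nodes := nodes_trans ht (children_subset_nodes (by simp [children]))
    have hsub : (binary l r).alive φ ⊆
        φ.crossing (binary l r).leafSet ∪ φ.crossing l.leafSet := by
      intro e he
      rw [mem_alive] at he
      obtain ⟨he, ⟨y, hy, hyx⟩, h⟩ := he
      have h1 := h l (by simp [children])
      have h2 := h r (by simp [children])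
      push Not at h1 h2
      rw [Finset.mem_union]
      by_cases hc : ∀ x ∈ e, x ∈ (binary l r).leaves
      · right
        obtain ⟨z, hz, hzr⟩ := h2
        have := hc z hz
        simp only [leaves, List.mem_append, hzr, or_false] at this
        exact MonotoneFormula.mem_crossing.2 ⟨he, ⟨z, hz, by simpa using this⟩, by simpa using h1⟩
      · left
        push Not at hc
        exact MonotoneFormula.mem_crossing.2 ⟨he, ⟨y, hy, by simpa using hyx⟩, by simpa using hc⟩
    have h1 := Finset.card_le_card hsub
    have h2 := Finset.card_union_le (φ.crossing (binary l r).leafSet) (φ.crossing l.leafSet)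
    have h3 := hM _ ht
    have h4 := hM _ hl
    omega

/-- A node of `T`, as an element of a type. -/
abbrev Node (T : VTree V) : Type u := {n : VTree V // n ∈ T.nodes}

noncomputable instance (T : VTree V) : Fintype T.Node := by
  classical
  exact Fintype.subtype T.nodes.toFinset (by simp)

open Classical in
/-- A parent map; the root is mapped to itself. -/
noncomputable def parent (T : VTree V) (n : T.Node) : T.Node :=
  if h : n.1 = T then n else
    ⟨(exists_parent n.2 h).choose, (exists_parent n.2 h).choose_spec.1⟩

theorem mem_children_parent {T : VTree V} {n : T.Node} (h : n.1 ≠ T) :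
    n.1 ∈ (T.parent n).1.children := by
  rw [parent, dif_neg h]
  exact (exists_parent n.2 h).choose_spec.2

theorem sizeOf_le_of_mem_nodes {T n : VTree V} (h : n ∈ T.nodes) : sizeOf n ≤ sizeOf T := by
  induction T with
  | leaf x => simp only [nodes, List.mem_singleton] at h; subst h; exact le_rfl
  | unary t ih =>
    simp only [nodes, List.mem_cons] at h
    rcases h with rfl | h
    · exact le_rfl
    · have := ih h; simp; omega
  | binary l r ihl ihr =>
    simp only [nodes, List.mem_cons, List.mem_append] at h
    rcases h with rfl | h | h
    · exact le_rfl
    · have := ihl h; simp; omega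
    · have := ihr h; simp; omega

theorem depth_parent_lt {T : VTree V} (n : T.Node) (h : n ≠ ⟨T, T.self_mem_nodes⟩) :
    sizeOf T - sizeOf (T.parent n).1 < sizeOf T - sizeOf n.1 := by
  have h1 := sizeOf_lt_of_mem_children (mem_children_parent (n := n) fun h' => h (Subtype.ext h'))
  have h2 := sizeOf_le_of_mem_nodes (T.parent n).2
  omega

/-- The graph whose edges link the nodes to their parents. -/
noncomputable def graph (T : VTree V) : SimpleGraph T.Node :=
  SimpleGraph.fromRel fun a b => a ≠ ⟨T, T.self_mem_nodes⟩ ∧ T.parent a = b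

theorem graph_adj {T : VTree V} (a b : T.Node) :
    T.graph.Adj a b ↔ (a ≠ ⟨T, T.self_mem_nodes⟩ ∧ T.parent a = b) ∨
      (b ≠ ⟨T, T.self_mem_nodes⟩ ∧ T.parent b = a) := by
  rw [graph, SimpleGraph.fromRel_adj, and_iff_right_iff_imp]
  rintro (⟨h, h'⟩ | ⟨h, h'⟩) rfl
  all_goals
    have := depth_parent_lt a h
    rw [h'] at this
    exact lt_irrefl _ this

open Classical in
/-- The tree decomposition given by a v-tree. -/
noncomputable def bag (φ : MonotoneFormula V) (t : VTree V) : Finset V :=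
  (t.alive φ).biUnion id

theorem mem_bag {φ : MonotoneFormula V} {t : VTree V} {x : V} :
    x ∈ t.bag φ ↔ ∃ e ∈ t.alive φ, x ∈ e := by
  simp [bag]

theorem card_bag_le [Fintype V] (φ : MonotoneFormula V) {T t : VTree V} {M : ℕ}
    (hM : ∀ n ∈ T.nodes, (φ.crossing n.leafSet).card ≤ M) (ht : t ∈ T.nodes) :
    (t.bag φ).card ≤ (2 * M + φ.degree) * φ.arity := by
  classical
  refine (Finset.card_biUnion_le_card_mul _ _ φ.arity fun e he => ?_).trans
    (Nat.mul_le_mul_right _ (card_alive_le φ hM ht))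
  exact MonotoneFormula.card_le_arity (mem_alive.1 he).1

/-- A lowest node that covers the clause `e`. -/
theorem exists_top {T : VTree V} (hT : ∀ x, x ∈ T.leaves) (e : Finset V) :
    ∃ n ∈ T.nodes, (∀ x ∈ e, x ∈ n.leaves) ∧ ∀ c ∈ n.children, ¬ ∀ x ∈ e, x ∈ c.leaves := by
  classical
  obtain ⟨n, hn, hmin⟩ := Finset.exists_min_image
    (T.nodes.toFinset.filter fun n => ∀ x ∈ e, x ∈ n.leaves) (fun n => sizeOf n)
    ⟨T, by simp [T.self_mem_nodes, hT]⟩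
  simp only [Finset.mem_filter, List.mem_toFinset] at hn hmin
  refine ⟨n, hn.1, hn.2, fun c hc hce => ?_⟩
  have := hmin c ⟨nodes_trans hn.1 (children_subset_nodes hc), hce⟩
  have := sizeOf_lt_of_mem_children hc
  omega

/-- The nodes where `e` is alive are those on the way up from the leaves in `e` to `top`, the lowest
node covering `e`; this set is closed under parents until `top`. -/
theorem alive_parent {φ : MonotoneFormula V} {T : VTree V} (hT : T.leaves.Nodup)
    {e : Finset V} {top n : T.Node} (htop : ∀ x ∈ e, x ∈ top.1.leaves)
    (htop' : ∀ c ∈ top.1.children, ¬ ∀ x ∈ e, x ∈ c.leaves)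
    (hn : e ∈ n.1.alive φ) (hne : n ≠ top) :
    n ≠ ⟨T, T.self_mem_nodes⟩ ∧ e ∈ (T.parent n).1.alive φ := by
  rw [mem_alive] at hn
  obtain ⟨he, ⟨x, hx, hxn⟩, hc⟩ := hn
  have hne' : n.1 ≠ top.1 := fun h => hne (Subtype.ext h)
  -- `n` is a proper descendant of `top`
  have hdesc : n.1 ∈ top.1.nodes := by
    rcases mem_nodes_or_mem_nodes hT n.2 top.2 hxn (htop x hx) with h | h
    · exact h
    · obtain ⟨c, hcn, hct⟩ := exists_child_of_mem_nodes h hne'.symm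
      exact (hc c hcn fun y hy => leaves_subset_of_mem_nodes hct (htop y hy)).elim
  obtain ⟨c, hct, hnc⟩ := exists_child_of_mem_nodes hdesc hne'
  have hnT : n.1 ≠ T := by
    intro h
    have h1 := sizeOf_le_of_mem_nodes hnc
    have h2 := sizeOf_lt_of_mem_children hct
    have h3 := sizeOf_le_of_mem_nodes top.2
    rw [h] at h1
    omega
  refine ⟨fun h => hnT (congrArg Subtype.val h), ?_⟩
  have hpar := mem_children_parent hnT
  rw [mem_alive]
  refine ⟨he, ⟨x, hx, leaves_subset_of_mem_children hpar hxn⟩, fun c' hc' hall => ?_⟩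
  -- the child `c'` of the parent covers `e`, hence is above or equal to `top`
  have hc'T : c' ∈ T.nodes := nodes_trans (T.parent n).2 (children_subset_nodes hc')
  have htc : top.1 ∈ c'.nodes := by
    rcases mem_nodes_or_mem_nodes hT top.2 hc'T (htop x hx) (hall x hx) with h | h
    · exact h
    · by_cases hcc : c' = top.1
      · rw [hcc]; exact self_mem_nodes _
      · obtain ⟨b, hb, hcb⟩ := exists_child_of_mem_nodes h hcc
        exact (htop' b hb fun y hy => leaves_subset_of_mem_nodes hcb (hall y hy)).elim
  have hnc' : n.1 ∈ c'.nodes := nodes_trans htc hdesc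
  by_cases hnc'' : n.1 = c'
  · have h1 := sizeOf_le_of_mem_nodes htc
    rw [← hnc''] at h1
    have h2 := sizeOf_le_of_mem_nodes hnc
    have h3 := sizeOf_lt_of_mem_children hct
    omega
  · cases hp : (T.parent n).1 with
    | leaf y => rw [hp] at hpar; simp [children] at hpar
    | unary t =>
      rw [hp] at hpar hc'
      simp only [children, List.mem_singleton] at hpar hc'
      exact hnc'' (hpar.trans hc'.symm)
    | binary l r =>
      have hnod : (binary l r).leaves.Nodup := hp ▸ nodup_of_mem_nodes hT (T.parent n).2
      rw [leaves, List.nodup_append'] at hnod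
      have hdisj := hnod.2.2
      rw [hp] at hpar hc'
      simp only [children, List.mem_cons, List.not_mem_nil, or_false] at hpar hc'
      have hxc' := hall x hx
      rcases hpar with h | h <;> rcases hc' with h' | h'
      · exact hnc'' (h.trans h'.symm)
      · rw [h] at hxn; rw [h'] at hxc'; exact hdisj hxn hxc'
      · rw [h] at hxn; rw [h'] at hxc'; exact hdisj hxc' hxn
      · exact hnc'' (h.trans h'.symm)

open Classical in
/-- The tree decomposition of `φ` along a v-tree. -/
noncomputable def treeDecomposition (φ : MonotoneFormula V) (T : VTree V) (hT : T.IsOver) :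
    TreeDecomposition φ where
  Node := T.Node
  tree := T.graph
  isTree := isTree_of_parent (d := fun n => sizeOf T - sizeOf n.1) depth_parent_lt graph_adj
  bag n := n.1.bag φ
  covers e he := by
    obtain ⟨n, hn, h1, h2⟩ := exists_top hT.2 e
    obtain ⟨x, hx⟩ := φ.clause_nonempty e he
    exact ⟨⟨n, hn⟩, fun y hy => mem_bag.2 ⟨e, mem_alive.2 ⟨he, ⟨x, hx, h1 x hx⟩, h2⟩, hy⟩⟩
  connected v := by
    set S : Set T.Node := {b | v ∈ b.1.bag φ} with hS
    have hadj : ∀ n, n ≠ ⟨T, T.self_mem_nodes⟩ → T.graph.Adj n (T.parent n) :=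
      fun n hn => (graph_adj _ _).2 (Or.inl ⟨hn, rfl⟩)
    -- every node of `S` is linked to the leaf `v`
    have key : ∀ n (hn : n ∈ S), ∃ h : (⟨leaf v, leaf_mem_nodes (hT.2 v)⟩ : T.Node) ∈ S,
        (T.graph.induce S).Reachable ⟨n, hn⟩ ⟨_, h⟩ := by
      intro n hn
      obtain ⟨e, he, hve⟩ := mem_bag.1 hn
      have hec := (mem_alive.1 he).1
      obtain ⟨top, ht, ht1, ht2⟩ := exists_top hT.2 e
      -- The nodes where `e` is alive include `n` and the leaf `v`, and both climb to `top` inside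
      -- this set, hence inside `S`.
      set S' : Set T.Node := {b | e ∈ b.1.alive φ} with hS'
      have hsub : S' ⊆ S := fun b hb => mem_bag.2 ⟨e, hb, hve⟩
      have hleaf : (⟨leaf v, leaf_mem_nodes (hT.2 v)⟩ : T.Node) ∈ S' :=
        mem_alive.2 ⟨hec, ⟨v, hve, by simp [leaves]⟩, by simp [children]⟩
      have htop : (⟨top, ht⟩ : T.Node) ∈ S' := mem_alive.2 ⟨hec, ⟨v, hve, ht1 v hve⟩, ht2⟩
      have hr := reachable_induce_of_parent_closed (d := fun n => sizeOf T - sizeOf n.1)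
        depth_parent_lt hadj htop fun s hs hne => alive_parent hT.1 ht1 ht2 hs hne
      refine ⟨hsub hleaf, ?_⟩
      exact ((hr n he).trans (hr _ hleaf).symm).map
        (SimpleGraph.induceHomOfLE T.graph hsub).toHom
    intro a b
    obtain ⟨h1, h2⟩ := key a.1 a.2
    obtain ⟨h3, h4⟩ := key b.1 b.2
    exact h2.trans h4.symm

end VTree

/-- If all cuts along a v-tree are small, then so is the treewidth. -/
theorem treewidth_le_of_vtree {V : Type u} [Fintype V] (φ : MonotoneFormula V) {T : VTree V}
    (hT : T.IsOver) {M : ℕ} (hM : ∀ n ∈ T.nodes, (φ.crossing n.leafSet).card ≤ M) :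
    φ.treewidth ≤ (2 * M + φ.degree) * φ.arity := by
  refine (treewidth_le (T.treeDecomposition φ hT)).trans ((Nat.sub_le _ _).trans ?_)
  exact Finset.sup_le fun b _ => VTree.card_bag_le φ hM b.2

/-! ### From tree decompositions to v-trees -/

section TreeDecompositionToVTree

variable {V : Type u} {φ : MonotoneFormula V} {M : ℕ}

/-- The set `A` is the set of leaves of a full v-tree along which all cuts have at most `M` crossing
clauses. -/
def HasVTree (φ : MonotoneFormula V) (M : ℕ) (A : Finset V) : Prop :=
  ∃ T : VTree V, T.IsFull ∧ T.leaves.Nodup ∧ T.leafSet = A ∧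
    ∀ n ∈ T.nodes, (φ.crossing n.leafSet).card ≤ M

theorem HasVTree.singleton {x : V} (h : (φ.crossing {x}).card ≤ M) : HasVTree φ M {x} := by
  have hx : (VTree.leaf x).leafSet = {x} := by ext y; simp [VTree.leaves]
  refine ⟨.leaf x, trivial, by simp [VTree.leaves], hx, fun n hn => ?_⟩
  simp only [VTree.nodes, List.mem_singleton] at hn
  subst hn
  rwa [hx]

open Classical in
theorem HasVTree.union {A B : Finset V} (hA : HasVTree φ M A) (hB : HasVTree φ M B)
    (hAB : Disjoint A B) (h : (φ.crossing (A ∪ B)).card ≤ M) : HasVTree φ M (A ∪ B) := by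
  obtain ⟨S, hS1, hS2, rfl, hS4⟩ := hA
  obtain ⟨T, hT1, hT2, rfl, hT4⟩ := hB
  have hU : (VTree.binary S T).leafSet = S.leafSet ∪ T.leafSet := by
    ext y; simp [VTree.leaves]
  refine ⟨.binary S T, ⟨hS1, hT1⟩, ?_, hU, fun n hn => ?_⟩
  · rw [VTree.leaves, List.nodup_append']
    refine ⟨hS2, hT2, fun x hx hx' => ?_⟩
    exact Finset.disjoint_left.1 hAB (VTree.mem_leafSet.2 hx) (VTree.mem_leafSet.2 hx')
  · rw [VTree.nodes, List.mem_cons, List.mem_append] at hn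
    rcases hn with rfl | hn | hn
    · rwa [hU]
    · exact hS4 n hn
    · exact hT4 n hn

open Classical in
-- The parts are attached one at a time by binary nodes, whose leaf sets are unions of subfamilies
-- of `P`; hence the hypothesis on all `Q ⊆ P`.
theorem HasVTree.sup {P : Finset (Finset V)} (hne : P.Nonempty)
    (hdisj : (P : Set (Finset V)).PairwiseDisjoint id) (hP : ∀ A ∈ P, HasVTree φ M A)
    (h : ∀ Q ⊆ P, (φ.crossing (Q.sup id)).card ≤ M) : HasVTree φ M (P.sup id) := by
  induction hne using Finset.Nonempty.cons_induction with
  | singleton A => simpa using hP A (Finset.mem_singleton_self A)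
  | cons A P hA hne ih =>
    have hrest := ih (hdisj.subset (by simp))
      (fun B hB => hP B (Finset.mem_cons_of_mem hB))
      (fun Q hQ => h Q (hQ.trans (Finset.subset_cons hA)))
    have hsup := h _ (subset_refl _)
    rw [Finset.sup_cons, id, Finset.sup_eq_union] at hsup ⊢
    refine HasVTree.union (hP A (Finset.mem_cons_self _ _)) hrest ?_ hsup
    rw [Finset.disjoint_sup_right]
    intro B hB
    exact hdisj (by simp) (by simp [hB]) (by rintro rfl; exact hA hB)

/-- If `A` consists of variables of the bag of `n` and of whole branches below `n`, then few clauses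
cross `A`. -/
theorem card_crossing_le [Fintype V] (D : TreeDecomposition φ) {par : D.Node → D.Node}
    (hpar : ∀ a b, D.tree.Adj a b → par a = b ∨ par b = a) {b : V → D.Node}
    (hb : ∀ x m, x ∈ D.bag m → x ∈ D.bag (b x)) {n : D.Node} {A : Finset V}
    (hA : ∀ x ∈ A, ∀ y ∉ A, b x = n ∨ ∃ c, par c = n ∧ Below par c (b x) ∧ ¬ Below par c (b y)) :
    (φ.crossing A).card ≤ (D.width + 1) * φ.degree := by
  classical
  have hbag : (D.bag n).card ≤ D.width + 1 := by
    have := Finset.le_sup (f := fun b => (D.bag b).card) (Finset.mem_univ n)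
    rw [TreeDecomposition.width]
    omega
  refine (Finset.card_le_card ?_).trans
    ((φ.card_filter_meet_le (D.bag n)).trans (Nat.mul_le_mul_right _ hbag))
  intro e he
  obtain ⟨he, ⟨x, hx, hxA⟩, ⟨y, hy, hyA⟩⟩ := MonotoneFormula.mem_crossing.1 he
  refine Finset.mem_filter.2 ⟨he, ?_⟩
  -- Some bag `m` contains both `x` and `y`. If the edge from `c` to `n` separates `b x` from `b y`,
  -- then it separates `m` from one of them, and that variable must occur in the bag of `n`.
  obtain ⟨m, hm⟩ := D.covers e he
  rcases hA x hxA y hyA with h | ⟨c, rfl, h1, h2⟩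
  · exact ⟨x, hx, h ▸ hb x m (hm hx)⟩
  · by_cases hc : Below par c m
    · exact ⟨y, hy, mem_of_preconnected_of_below hpar (D.connected y) (hm hy)
        (hb y m (hm hy)) hc h2⟩
    · exact ⟨x, hx, mem_of_preconnected_of_below hpar (D.connected x)
        (hb x m (hm hx)) (hm hx) h1 hc⟩

open Classical in
/-- Every tree decomposition gives a v-tree along which all cuts are small. -/
theorem exists_vtree [Fintype V] (D : TreeDecomposition φ) :
    ∃ T : VTree V, T.IsFull ∧ T.IsOver ∧
      ∀ n ∈ T.nodes, (φ.crossing n.leafSet).card ≤ (D.width + 1) * φ.degree := by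
  obtain ⟨r⟩ := D.isTree.connected.nonempty
  obtain ⟨par, d, hr, hd, hpar⟩ := exists_parent_of_isTree D.isTree r
  -- Each variable gets a home node `b x` whose bag contains it; variables in no bag are sent to the
  -- root.
  have hex : ∀ x, ∃ n, ∀ m, x ∈ D.bag m → x ∈ D.bag n := by
    intro x
    by_cases h : ∃ m, x ∈ D.bag m
    · obtain ⟨n, hn⟩ := h
      exact ⟨n, fun _ _ => hn⟩
    · exact ⟨r, fun m hm => (h ⟨m, hm⟩).elim⟩
  choose b hb using hex
  set M := (D.width + 1) * φ.degree with hM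
  set branch : D.Node → Finset V := fun n => Finset.univ.filter fun x => Below par n (b x)
    with hbranch
  have mem_branch : ∀ n x, x ∈ branch n ↔ Below par n (b x) := by simp [hbranch]
  have hsingle : ∀ x, HasVTree φ M {x} := fun x => HasVTree.singleton <| by
    refine (Finset.card_le_card ?_).trans ((φ.card_filter_mem_le_degree x).trans
      (Nat.le_mul_of_pos_left _ (Nat.succ_pos _)))
    intro e he
    obtain ⟨hc, ⟨y, hy, hyx⟩, -⟩ := MonotoneFormula.mem_crossing.1 he
    rw [Finset.mem_singleton] at hyx
    exact Finset.mem_filter.2 ⟨hc, hyx ▸ hy⟩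
  have key : ∀ n, (branch n).Nonempty → HasVTree φ M (branch n) := by
    intro n
    -- Induction from the deepest nodes upwards.
    induction h : Finset.univ.sup d - d n using Nat.strong_induction_on generalizing n with
    | _ k ih =>
      intro hne
      -- The branch of `n` splits into singletons of the variables at home in `n` and the branches
      -- of its children. Empty branches are dropped, since a v-tree has a leaf.
      set P₁ : Finset (Finset V) := (Finset.univ.filter fun x => b x = n).image fun x => {x}
        with hP₁
      set P₂ : Finset (Finset V) := (Finset.univ.filter fun c =>
        c ≠ n ∧ par c = n ∧ (branch c).Nonempty).image branch with hP₂
      have hmem₁ : ∀ A, A ∈ P₁ ↔ ∃ x, b x = n ∧ {x} = A := by simp [hP₁]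
      have hmem₂ : ∀ A, A ∈ P₂ ↔ ∃ c, (c ≠ n ∧ par c = n ∧ (branch c).Nonempty) ∧ branch c = A := by
        simp [hP₂]
      have hnot : ∀ c, c ≠ n → par c = n → ¬ Below par c n := by
        intro c hc hcn hb
        have h1 := depth_le_of_below hr hd hb
        have hcr : c ≠ r := by rintro rfl; exact hc (hr.symm.trans hcn)
        have h2 := hd c hcr
        rw [hcn] at h2
        omega
      have hunion : (P₁ ∪ P₂).sup id = branch n := by
        ext x
        rw [Finset.mem_sup, mem_branch]
        constructor
        · rintro ⟨A, hA, hx⟩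
          rcases Finset.mem_union.1 hA with hA | hA
          · obtain ⟨y, hy, rfl⟩ := (hmem₁ A).1 hA
            simp only [id, Finset.mem_singleton] at hx
            rw [hx, hy]
            exact Below.refl _
          · obtain ⟨c, ⟨-, hc, -⟩, rfl⟩ := (hmem₂ A).1 hA
            exact hc ▸ ((mem_branch c x).1 hx).parent
        · intro hx
          rcases hx.eq_or_child with hx | ⟨c, hc, hcn, hcx⟩
          · exact ⟨{x}, Finset.mem_union_left _ ((hmem₁ _).2 ⟨x, hx, rfl⟩), by simp⟩
          · have := (mem_branch c x).2 hcx
            exact ⟨branch c, Finset.mem_union_right _ ((hmem₂ _).2 ⟨c, ⟨hc, hcn, ⟨x, this⟩⟩, rfl⟩),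
              this⟩
      rw [← hunion]
      apply HasVTree.sup
      · rw [Finset.nonempty_iff_ne_empty]
        intro h0
        rw [h0, Finset.sup_empty] at hunion
        rw [← hunion] at hne
        simp at hne
      · intro A hA B hB hAB
        rw [Function.onFun, id, id, Finset.disjoint_left]
        intro x hxA hxB
        apply hAB
        rw [Finset.mem_coe, Finset.mem_union] at hA hB
        rcases hA with hA | hA <;> rcases hB with hB | hB
        · obtain ⟨y, -, rfl⟩ := (hmem₁ A).1 hA
          obtain ⟨z, -, rfl⟩ := (hmem₁ B).1 hB
          rw [Finset.mem_singleton] at hxA hxB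
          rw [← hxA, ← hxB]
        · obtain ⟨y, hy, rfl⟩ := (hmem₁ A).1 hA
          obtain ⟨c, ⟨h1, h2, -⟩, rfl⟩ := (hmem₂ B).1 hB
          rw [Finset.mem_singleton] at hxA
          rw [mem_branch, hxA, hy] at hxB
          exact (hnot c h1 h2 hxB).elim
        · obtain ⟨y, hy, rfl⟩ := (hmem₁ B).1 hB
          obtain ⟨c, ⟨h1, h2, -⟩, rfl⟩ := (hmem₂ A).1 hA
          rw [Finset.mem_singleton] at hxB
          rw [mem_branch, hxB, hy] at hxA
          exact (hnot c h1 h2 hxA).elim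
        · obtain ⟨c, ⟨h1, h2, -⟩, rfl⟩ := (hmem₂ A).1 hA
          obtain ⟨c', ⟨h1', h2', -⟩, rfl⟩ := (hmem₂ B).1 hB
          rw [mem_branch] at hxA hxB
          rw [child_eq_of_below hr hd h1 h1' h2 h2' hxA hxB]
      · intro A hA
        rcases Finset.mem_union.1 hA with hA | hA
        · obtain ⟨x, -, rfl⟩ := (hmem₁ A).1 hA
          exact hsingle x
        · obtain ⟨c, ⟨hc, hcn, hne'⟩, rfl⟩ := (hmem₂ A).1 hA
          refine ih _ ?_ c rfl hne'
          have hcr : c ≠ r := by rintro rfl; exact hc (hr.symm.trans hcn)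
          have h2 := hd c hcr
          rw [hcn] at h2
          have h3 := Finset.le_sup (f := d) (Finset.mem_univ c)
          omega
      · intro Q hQ
        refine card_crossing_le D hpar hb (n := n) fun x hx y hy => ?_
        rw [Finset.mem_sup] at hx hy
        obtain ⟨A, hA, hx⟩ := hx
        rcases Finset.mem_union.1 (hQ hA) with hA' | hA'
        · obtain ⟨z, hz, rfl⟩ := (hmem₁ A).1 hA'
          left
          rw [id, Finset.mem_singleton] at hx
          rw [hx, hz]
        · obtain ⟨c, ⟨-, hcn, -⟩, rfl⟩ := (hmem₂ A).1 hA'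
          exact Or.inr ⟨c, hcn, (mem_branch c x).1 hx, fun h =>
            hy ⟨branch c, hA, (mem_branch c y).2 h⟩⟩
  have hroot : ∀ x, x ∈ branch r := fun x => (mem_branch r x).2 (below_root hd _)
  obtain ⟨x⟩ := φ.nonempty_vars
  obtain ⟨T, h1, h2, h3, h4⟩ := key r ⟨x, hroot x⟩
  exact ⟨T, h1, ⟨h2, fun y => VTree.mem_leafSet.1 (h3 ▸ hroot y)⟩, h4⟩

end TreeDecompositionToVTree

/-! ### Circuits from v-trees with few subfunctions -/

section Glue

variable {V : Type u}

open Classical in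
/-- The valuation that agrees with `ν` on `A` and with `μ` outside of `A`. -/
noncomputable def glue (A : Finset V) (ν μ : V → Bool) : V → Bool :=
  fun x => if x ∈ A then ν x else μ x

theorem glue_of_mem {A : Finset V} {ν μ : V → Bool} {x : V} (h : x ∈ A) : glue A ν μ x = ν x :=
  if_pos h

theorem glue_of_notMem {A : Finset V} {ν μ : V → Bool} {x : V} (h : x ∉ A) :
    glue A ν μ x = μ x :=
  if_neg h

end Glue

/-! ### Evaluation and size of circuits -/

namespace Circuit

variable {V : Type u} (C : Circuit V)

theorem eval_var {g : C.Gate} {x : V} (h : C.kind g = .var x) (ν : V → Bool) :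
    C.eval ν g = ν x := by
  rw [eval_eq]; simp [h]

theorem eval_not {g : C.Gate} (h : C.kind g = .not) (ν : V → Bool) :
    C.eval ν g = true ↔ ∃ g', C.wire g' g ∧ C.eval ν g' = false := by
  rw [eval_eq]; simp [h]

theorem eval_or {g : C.Gate} (h : C.kind g = .or) (ν : V → Bool) :
    C.eval ν g = true ↔ ∃ g', C.wire g' g ∧ C.eval ν g' = true := by
  rw [eval_eq]; simp [h]

theorem eval_and {g : C.Gate} (h : C.kind g = .and) (ν : V → Bool) :
    C.eval ν g = true ↔ ∀ g', C.wire g' g → C.eval ν g' = true := by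
  rw [eval_eq]; simp [h]

theorem vars_subset_of_monotone (supp : C.Gate → Set V)
    (hvar : ∀ g x, C.kind g = .var x → x ∈ supp g)
    (hwire : ∀ g' g, C.wire g' g → supp g' ⊆ supp g) (g : C.Gate) : C.vars g ⊆ supp g := by
  rintro x ⟨g', hg', h⟩
  induction h with
  | refl => exact hvar _ _ hg'
  | tail _ hw ih => exact hwire _ _ hw ih

/-- A wire is determined by its target and the index in `L` of its source. -/
theorem size_le_of_fanIn {L : Type*} [Fintype L]
    (h : ∀ g, ∃ F : L → C.Gate, ∀ g', C.wire g' g → ∃ l, F l = g') :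
    C.size ≤ Nat.card C.Gate * (Fintype.card L + 1) := by
  choose F hF using h
  choose l hl using hF
  have hinj : Function.Injective (fun p : {p : C.Gate × C.Gate // C.wire p.1 p.2} =>
      ((p.1.2, l p.1.2 p.1.1 p.2) : C.Gate × L)) := by
    rintro ⟨⟨a, b⟩, hp⟩ ⟨⟨a', b'⟩, hp'⟩ heq
    simp only [Prod.mk.injEq] at heq
    obtain ⟨rfl, h2⟩ := heq
    have h3 := hl b a hp
    rw [h2, hl b a' hp'] at h3
    subst h3
    rfl
  have := Nat.card_le_card_of_injective _ hinj
  rw [Nat.card_prod, Nat.card_eq_fintype_card (α := L)] at this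
  rw [size, Nat.mul_add, Nat.mul_one, Nat.add_comm]
  exact Nat.add_le_add_right this _

end Circuit

/-! ### The deterministic structured circuit of states along a v-tree -/

section StateCircuit

variable {V : Type u} {T : VTree V} {N : ℕ}

/-- The gates of the circuit that computes bottom-up, for each node `n` of a v-tree, the state of
`n` among `N` possible ones. -/
inductive StateGate (T : VTree V) (N : ℕ) : Type u
  | var (x : V)
  | neg (x : V)
  | state (n : T.Node) (i : Fin N)
  | pair (n : T.Node) (i j : Fin N)
  | out

namespace StateGate

/-- The type of a gate. -/
def kind : StateGate T N → GateKind V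
  | var x => .var x
  | neg _ => .not
  | state _ _ => .or
  | pair _ _ _ => .and
  | out => .or

/-- The wires, for the map `code n` from valuations to states of the node `n`. -/
def Wire (code : VTree V → (V → Bool) → Fin N) (f : (V → Bool) → Prop) :
    StateGate T N → StateGate T N → Prop
  | var x, neg y => x = y
  | var x, state n i => n.1 = .leaf x ∧ ∃ ν, ν x = true ∧ code n.1 ν = i
  | neg x, state n i => n.1 = .leaf x ∧ ∃ ν, ν x = false ∧ code n.1 ν = i
  -- Only triples realized by a common valuation are wired; under `IsCode.binary` the pair `(i, j)`
  -- then determines `k`.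
  | pair m i j, state n k => m = n ∧ ∃ l r, n.1 = .binary l r ∧
      ∃ ν, code l ν = i ∧ code r ν = j ∧ code n.1 ν = k
  | state m k, pair n i j => ∃ l r, n.1 = .binary l r ∧ (m.1 = l ∧ k = i ∨ m.1 = r ∧ k = j)
  | state m i, out => m.1 = T ∧ ∃ ν, code T ν = i ∧ f ν
  | _, _ => False

/-- The height of a gate. -/
noncomputable def rank : StateGate T N → ℕ
  | var _ => 0
  | neg _ => 1
  | state n _ => 2 * sizeOf n.1
  | pair n _ _ => 2 * sizeOf n.1 - 1
  | out => 2 * sizeOf T + 1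

theorem rank_lt_of_wire {code : VTree V → (V → Bool) → Fin N} {f : (V → Bool) → Prop}
    {g' g : StateGate T N} (h : Wire code f g' g) : rank g' < rank g := by
  cases g' with
  | var x =>
    cases g with
    | neg y => simp [rank]
    | state n i => simp only [rank, h.1]; simp
    | _ => exact h.elim
  | neg x =>
    cases g with
    | state n i => simp only [rank, h.1]; simp
    | _ => exact h.elim
  | state m k =>
    cases g with
    | pair n i j =>
      obtain ⟨l, r, h, h' | h'⟩ := h <;> simp only [rank, h, h'.1] <;> simp <;> omega
    | out => simp only [rank, h.1]; omega
    | _ => exact h.elim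
  | pair m i j =>
    cases g with
    | state n k =>
      obtain ⟨rfl, l, r, h, -⟩ := h
      simp only [rank, h]; simp
    | _ => exact h.elim
  | out => cases g <;> exact h.elim

/-- The gates, as a sum type. -/
def toSum : StateGate T N →
    (V ⊕ V) ⊕ ((T.Node × Fin N) ⊕ (T.Node × Fin N × Fin N)) ⊕ Unit
  | var x => .inl (.inl x)
  | neg x => .inl (.inr x)
  | state n i => .inr (.inl (.inl (n, i)))
  | pair n i j => .inr (.inl (.inr (n, i, j)))
  | out => .inr (.inr ())

theorem toSum_injective : Function.Injective (toSum : StateGate T N → _) := by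
  intro a b h
  cases a <;> cases b <;> simp_all [toSum]

instance [Finite V] : Finite (StateGate T N) :=
  Finite.of_injective _ toSum_injective

theorem card_le [Fintype V] : Nat.card (StateGate T N) ≤
    2 * Fintype.card V + (Fintype.card T.Node * N + Fintype.card T.Node * (N * N) + 1) := by
  refine (Nat.card_le_card_of_injective _ toSum_injective).trans (le_of_eq ?_)
  simp only [Nat.card_eq_fintype_card, Fintype.card_sum, Fintype.card_prod, Fintype.card_fin,
    Fintype.card_unit]
  ring

/-- The variables below a gate. -/
def supp : StateGate T N → Set V
  | var x => {x}
  | neg x => {x}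
  | state n _ => {x | x ∈ n.1.leaves}
  | pair n _ _ => {x | x ∈ n.1.leaves}
  | out => {x | x ∈ T.leaves}

theorem supp_subset_of_wire {code : VTree V → (V → Bool) → Fin N} {f : (V → Bool) → Prop}
    {g' g : StateGate T N} (h : Wire code f g' g) : supp g' ⊆ supp g := by
  cases g' with
  | var x =>
    cases g with
    | neg y => simp only [Wire] at h; simp [supp, h]
    | state n i => simp [supp, h.1, VTree.leaves]
    | _ => exact h.elim
  | neg x =>
    cases g with
    | state n i => simp [supp, h.1, VTree.leaves]
    | _ => exact h.elim
  | state m k =>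
    cases g with
    | pair n i j =>
      obtain ⟨l, r, h, h' | h'⟩ := h <;>
        (intro x; simp only [supp, h, h'.1, VTree.leaves, List.mem_append, Set.mem_ofPred_eq]; tauto)
    | out => simp [supp, h.1]
    | _ => exact h.elim
  | pair m i j =>
    cases g with
    | state n k => simp [supp, h.1]
    | _ => exact h.elim
  | out => cases g <;> exact h.elim

/-- `N * N + 2` indices suffice for a state gate: all pairs of child states, and the two literals at
a leaf. For the other gates the surplus indices take a default value. -/
theorem exists_inputs (code : VTree V → (V → Bool) → Fin N) (f : (V → Bool) → Prop)
    (g : StateGate T N) : ∃ F : (Fin N × Fin N) ⊕ Bool → StateGate T N,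
      ∀ g', Wire code f g' g → ∃ l, F l = g' := by
  classical
  cases g with
  | var x => exact ⟨fun _ => .out, fun g' h => by cases g' <;> exact h.elim⟩
  | neg x =>
    refine ⟨fun _ => .var x, fun g' h => ⟨.inr true, ?_⟩⟩
    cases g' with
    | var y => simp only [Wire] at h; rw [h]
    | _ => exact h.elim
  | state n k =>
    have hx : ∃ x, ∀ y, n.1 = .leaf y → y = x := by
      obtain ⟨x, -⟩ := n.1.exists_mem_leaves
      by_cases h : ∃ z, n.1 = .leaf z
      · obtain ⟨z, hz⟩ := h
        exact ⟨z, fun y hy => by rw [hz] at hy; cases hy; rfl⟩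
      · exact ⟨x, fun y hy => (h ⟨y, hy⟩).elim⟩
    obtain ⟨x, hx⟩ := hx
    refine ⟨Sum.elim (fun p => .pair n p.1 p.2) fun b => if b then .var x else .neg x,
      fun g' h => ?_⟩
    cases g' with
    | var y => exact ⟨.inr true, by simp [hx y h.1]⟩
    | neg y => exact ⟨.inr false, by simp [hx y h.1]⟩
    | pair m i j => exact ⟨.inl (i, j), by simp [h.1]⟩
    | _ => exact h.elim
  | pair n i j =>
    by_cases hn : ∃ l r : T.Node, n.1 = .binary l.1 r.1
    · obtain ⟨l, r, hn⟩ := hn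
      refine ⟨Sum.elim (fun _ => .out) fun b => if b then .state l i else .state r j,
        fun g' h => ?_⟩
      cases g' with
      | state m k =>
        obtain ⟨l', r', h, h' | h'⟩ := h
        · rw [hn] at h; cases h
          exact ⟨.inr true, by simp [h'.2, Subtype.ext h'.1]⟩
        · rw [hn] at h; cases h
          exact ⟨.inr false, by simp [h'.2, Subtype.ext h'.1]⟩
      | _ => exact h.elim
    · refine ⟨fun _ => .out, fun g' h => ?_⟩
      cases g' with
      | state m k =>
        obtain ⟨l', r', h, -⟩ := h
        have hc : ∀ c ∈ n.1.children, c ∈ T.nodes :=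
          fun c hc => VTree.nodes_trans n.2 (VTree.children_subset_nodes hc)
        exact (hn ⟨⟨l', hc l' (by simp [h, VTree.children])⟩,
          ⟨r', hc r' (by simp [h, VTree.children])⟩, h⟩).elim
      | _ => exact h.elim
  | out =>
    refine ⟨Sum.elim (fun p => .state ⟨T, T.self_mem_nodes⟩ p.1) fun _ => .out, fun g' h => ?_⟩
    cases g' with
    | state m i => exact ⟨.inl (i, i), by simp [Subtype.ext_iff, h.1]⟩
    | _ => exact h.elim

end StateGate

/-- The circuit that computes the states of all nodes of a v-tree. -/
def stateCircuit [Finite V] (T : VTree V) (code : VTree V → (V → Bool) → Fin N)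
    (f : (V → Bool) → Prop) : Circuit V where
  Gate := StateGate T N
  kind := StateGate.kind
  wire := StateGate.Wire code f
  output := .out
  acyclic g h := by
    have : ∀ a b : StateGate T N, Relation.TransGen (StateGate.Wire code f) a b →
        StateGate.rank a < StateGate.rank b := by
      intro a b h
      induction h with
      | single h => exact StateGate.rank_lt_of_wire h
      | tail _ h ih => exact ih.trans (StateGate.rank_lt_of_wire h)
    exact lt_irrefl _ (this g g h)
  var_unique x := by
    refine ⟨.var x, rfl, fun g hg => ?_⟩
    cases g <;> simp_all [StateGate.kind]
  var_fanIn g x hg g' h := by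
    cases g <;> simp only [StateGate.kind, reduceCtorEq] at hg
    cases g' <;> exact h.elim
  not_fanIn g hg := by
    cases g <;> simp only [StateGate.kind, reduceCtorEq] at hg
    rename_i x
    refine ⟨.var x, rfl, fun g' h => ?_⟩
    cases g' with
    | var y => simp only [StateGate.Wire] at h; rw [h]
    | _ => exact h.elim

/-- The maps `code n` compute the states of the nodes from those of their children. -/
structure IsCode (T : VTree V) (code : VTree V → (V → Bool) → Fin N) (f : (V → Bool) → Prop) :
    Prop where
  leaf : ∀ x, VTree.leaf x ∈ T.nodes → ∀ ν μ : V → Bool, ν x = μ x →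
    code (.leaf x) ν = code (.leaf x) μ
  binary : ∀ l r, VTree.binary l r ∈ T.nodes → ∀ ν μ, code l ν = code l μ → code r ν = code r μ →
    code (.binary l r) ν = code (.binary l r) μ
  root : ∀ ν μ, code T ν = code T μ → (f ν ↔ f μ)

section

variable [Finite V] {code : VTree V → (V → Bool) → Fin N} {f : (V → Bool) → Prop}

theorem eval_state_var (ν : V → Bool) (x : V) :
    (stateCircuit T code f).eval ν (.var x) = ν x :=
  Circuit.eval_var (stateCircuit T code f) (g := StateGate.var x) rfl ν

theorem eval_state_neg (ν : V → Bool) (x : V) :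
    (stateCircuit T code f).eval ν (.neg x) = true ↔ ν x = false := by
  refine (Circuit.eval_not (stateCircuit T code f) (g := StateGate.neg x) rfl ν).trans ⟨?_, fun h => ?_⟩
  · rintro ⟨g', hw, h⟩
    change StateGate.Wire code f g' _ at hw
    cases g' with
    | var y =>
      simp only [StateGate.Wire] at hw
      rw [← hw, ← h]
      exact (eval_state_var ν y).symm
    | _ => exact hw.elim
  · exact ⟨StateGate.var x, rfl, (eval_state_var ν x).trans h⟩

/-- The valuation witnessing a wire may differ from `ν`, but it agrees with `ν` at the leaf, or in
the states of the two children, and `IsCode` then forces the same state. In particular exactly one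
state gate per node is true. -/
theorem eval_state (hcode : IsCode T code f) (hT : T.IsFull) (ν : V → Bool) (n : VTree V)
    (hn : n ∈ T.nodes) (k : Fin N) :
    (stateCircuit T code f).eval ν (.state ⟨n, hn⟩ k) = true ↔ code n ν = k := by
  induction n generalizing k with
  | leaf x =>
    refine (Circuit.eval_or (stateCircuit T code f) (g := StateGate.state _ _) rfl ν).trans ⟨?_, fun h => ?_⟩
    · rintro ⟨g', hw, h⟩
      change StateGate.Wire code f g' _ at hw
      cases g' with
      | var y =>
        obtain ⟨h1, μ, h2, h3⟩ := hw
        cases h1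
        rw [← h3]
        exact hcode.leaf x hn _ _ (((eval_state_var ν x).symm.trans h).trans h2.symm)
      | neg y =>
        obtain ⟨h1, μ, h2, h3⟩ := hw
        cases h1
        rw [← h3]
        exact hcode.leaf x hn _ _ (((eval_state_neg ν x).1 h).trans h2.symm)
      | pair m i j =>
        obtain ⟨rfl, l, r, h1, -⟩ := hw
        cases h1
      | _ => exact hw.elim
    · cases hx : ν x
      · exact ⟨StateGate.neg x, ⟨rfl, ν, hx, h⟩, (eval_state_neg ν x).2 hx⟩
      · exact ⟨StateGate.var x, ⟨rfl, ν, hx, h⟩, (eval_state_var ν x).trans hx⟩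
  | unary t => exact (hT.of_mem_nodes hn).elim
  | binary l r ihl ihr =>
    have hl : l ∈ T.nodes :=
      VTree.nodes_trans hn (VTree.children_subset_nodes (by simp [VTree.children]))
    have hr : r ∈ T.nodes :=
      VTree.nodes_trans hn (VTree.children_subset_nodes (by simp [VTree.children]))
    have hpair : ∀ i j, (stateCircuit T code f).eval ν (.pair ⟨_, hn⟩ i j) = true ↔
        code l ν = i ∧ code r ν = j := by
      intro i j
      refine (Circuit.eval_and (stateCircuit T code f) (g := StateGate.pair _ _ _) rfl ν).trans ⟨fun h => ?_, ?_⟩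
      · exact ⟨(ihl hl i).1 (h (StateGate.state ⟨l, hl⟩ i) ⟨l, r, rfl, .inl ⟨rfl, rfl⟩⟩),
          (ihr hr j).1 (h (StateGate.state ⟨r, hr⟩ j) ⟨l, r, rfl, .inr ⟨rfl, rfl⟩⟩)⟩
      · rintro ⟨h1, h2⟩ g' hw
        change StateGate.Wire code f g' _ at hw
        cases g' with
        | state m k =>
          obtain ⟨m, hm⟩ := m
          obtain ⟨l', r', h, ⟨rfl, rfl⟩ | ⟨rfl, rfl⟩⟩ := hw
          · cases h; exact (ihl hm _).2 h1
          · cases h; exact (ihr hm _).2 h2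
        | _ => exact hw.elim
    refine (Circuit.eval_or (stateCircuit T code f) (g := StateGate.state _ _) rfl ν).trans ⟨?_, fun h => ?_⟩
    · rintro ⟨g', hw, h⟩
      change StateGate.Wire code f g' _ at hw
      cases g' with
      | var y => cases hw.1
      | neg y => cases hw.1
      | pair m i j =>
        obtain ⟨rfl, l', r', h1, μ, h2, h3, h4⟩ := hw
        cases h1
        obtain ⟨h5, h6⟩ := (hpair i j).1 h
        rw [← h4]
        exact hcode.binary l r hn _ _ (h5.trans h2.symm) (h6.trans h3.symm)
      | _ => exact hw.elim
    · exact ⟨StateGate.pair ⟨_, hn⟩ (code l ν) (code r ν), ⟨rfl, l, r, rfl, ν, rfl, rfl, h⟩,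
        (hpair _ _).2 ⟨rfl, rfl⟩⟩

theorem eval_pair (hcode : IsCode T code f) (hT : T.IsFull) (ν : V → Bool) {l r : VTree V}
    (hn : VTree.binary l r ∈ T.nodes) {i j : Fin N}
    (h : (stateCircuit T code f).eval ν (.pair ⟨_, hn⟩ i j) = true) :
    code l ν = i ∧ code r ν = j := by
  have h := (Circuit.eval_and (stateCircuit T code f) (g := StateGate.pair _ _ _) rfl ν).1 h
  have hl : l ∈ T.nodes :=
    VTree.nodes_trans hn (VTree.children_subset_nodes (by simp [VTree.children]))
  have hr : r ∈ T.nodes :=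
    VTree.nodes_trans hn (VTree.children_subset_nodes (by simp [VTree.children]))
  exact ⟨(eval_state hcode hT ν l hl i).1
      (h (StateGate.state ⟨l, hl⟩ i) ⟨l, r, rfl, .inl ⟨rfl, rfl⟩⟩),
    (eval_state hcode hT ν r hr j).1
      (h (StateGate.state ⟨r, hr⟩ j) ⟨l, r, rfl, .inr ⟨rfl, rfl⟩⟩)⟩

theorem captures_stateCircuit (hcode : IsCode T code f) (hT : T.IsFull) :
    (stateCircuit T code f).Captures f := by
  intro ν
  refine (Circuit.eval_or (stateCircuit T code f) (g := StateGate.out) rfl ν).trans ⟨?_, fun h => ?_⟩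
  · rintro ⟨g', hw, h⟩
    change StateGate.Wire code f g' _ at hw
    cases g' with
    | state m i =>
      obtain ⟨m, hm⟩ := m
      obtain ⟨h0, μ, h1, h2⟩ := hw
      have h := (eval_state hcode hT ν m hm i).1 h
      rw [show m = T from h0] at h
      exact (hcode.root ν μ (h.trans h1.symm)).2 h2
    | _ => exact hw.elim
  · exact ⟨StateGate.state ⟨T, T.self_mem_nodes⟩ (code T ν), ⟨rfl, ν, rfl, h⟩,
      (eval_state hcode hT ν T _ _).2 rfl⟩

theorem vars_stateCircuit_subset (g : StateGate T N) :
    (stateCircuit T code f).vars g ⊆ StateGate.supp g := by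
  refine Circuit.vars_subset_of_monotone (stateCircuit T code f) (StateGate.supp (T := T) (N := N)) ?_ ?_ g
  · intro g x h
    change StateGate.kind g = _ at h
    cases g <;> simp_all [StateGate.kind, StateGate.supp]
  · exact fun g' g h => StateGate.supp_subset_of_wire (code := code) (f := f) h

omit [Finite V] in
theorem leaves_disjoint_of_binary (hT : T.IsOver) {l r : VTree V}
    (h : VTree.binary l r ∈ T.nodes) : List.Disjoint l.leaves r.leaves := by
  have := VTree.nodup_of_mem_nodes hT.1 h
  rw [VTree.leaves, List.nodup_append'] at this
  exact this.2.2

/-- Determinism holds since distinct inputs of an OR-gate assert opposite literals, different pairs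
of states of the same two children, or different states of the root. The inputs of an AND-gate
belong to the two children of one node of `T`, so `T` itself structures the circuit. -/
theorem isDSDNNF_stateCircuit (hcode : IsCode T code f) (hT : T.IsFull) (hT' : T.IsOver) :
    (stateCircuit T code f).IsDSDNNF := by
  refine ⟨⟨?_, ?_, T, hT', ?_⟩, ?_⟩
  · intro g hg g' hw
    change StateGate.kind g = _ at hg
    change StateGate.Wire code f g' g at hw
    cases g <;> simp only [StateGate.kind, reduceCtorEq] at hg
    cases g' with
    | var y => exact ⟨y, rfl⟩
    | _ => exact hw.elim
  · intro g hg g₁ g₂ h₁ h₂ hne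
    change StateGate.kind g = _ at hg
    change StateGate.Wire code f g₁ g at h₁
    change StateGate.Wire code f g₂ g at h₂
    refine Set.disjoint_of_subset (vars_stateCircuit_subset g₁) (vars_stateCircuit_subset g₂) ?_
    cases g <;> simp only [StateGate.kind, reduceCtorEq] at hg
    rename_i n i j
    obtain ⟨n, hn⟩ := n
    cases g₁ with
    | state m₁ k₁ =>
      cases g₂ with
      | state m₂ k₂ =>
        obtain ⟨m₁, hm₁⟩ := m₁
        obtain ⟨m₂, hm₂⟩ := m₂
        obtain ⟨l, r, h, h₁⟩ := h₁
        obtain ⟨l', r', h', h₂⟩ := h₂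
        simp only at h h' h₁ h₂
        subst h
        cases h'
        have hd := leaves_disjoint_of_binary hT' hn
        rw [Set.disjoint_left]
        rcases h₁ with ⟨rfl, rfl⟩ | ⟨rfl, rfl⟩ <;> rcases h₂ with ⟨rfl, rfl⟩ | ⟨rfl, rfl⟩
        · exact (hne rfl).elim
        · exact fun x h h' => hd h h'
        · exact fun x h h' => hd h' h
        · exact (hne rfl).elim
      | _ => exact h₂.elim
    | _ => exact h₁.elim
  · rintro g hg ⟨g', hw⟩
    change StateGate.kind g = _ at hg
    change StateGate.Wire code f g' g at hw
    cases g <;> simp only [StateGate.kind, reduceCtorEq] at hg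
    rename_i n i j
    obtain ⟨n, hn⟩ := n
    cases g' with
    | state m k =>
      obtain ⟨l, r, h, -⟩ := hw
      simp only at h
      subst h
      have hl : l ∈ T.nodes :=
        VTree.nodes_trans hn (VTree.children_subset_nodes (by simp [VTree.children]))
      have hr : r ∈ T.nodes :=
        VTree.nodes_trans hn (VTree.children_subset_nodes (by simp [VTree.children]))
      have hd := leaves_disjoint_of_binary hT' hn
      have hlr : l ≠ r := by
        rintro rfl
        obtain ⟨x, hx⟩ := l.exists_mem_leaves
        exact hd hx hx
      have hnodup : ([.state ⟨l, hl⟩ i, .state ⟨r, hr⟩ j] : List (StateGate T N)).Nodup := by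
        simp [hlr]
      have hmem : ∀ g', g' ∈ ([.state ⟨l, hl⟩ i, .state ⟨r, hr⟩ j] : List (StateGate T N)) ↔
          StateGate.Wire code f g' (.pair ⟨_, hn⟩ i j) := by
        intro g'
        rw [List.mem_cons, List.mem_singleton]
        constructor
        · rintro (rfl | rfl)
          · exact ⟨l, r, rfl, .inl ⟨rfl, rfl⟩⟩
          · exact ⟨l, r, rfl, .inr ⟨rfl, rfl⟩⟩
        · intro hw
          cases g' with
          | state m k =>
            obtain ⟨m, hm⟩ := m
            obtain ⟨l', r', h, ⟨rfl, rfl⟩ | ⟨rfl, rfl⟩⟩ := hw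
            · cases h; exact .inl rfl
            · cases h; exact .inr rfl
          | _ => exact hw.elim
      exact ⟨_, hn, _, hnodup, hmem, .cons (fun _ hx => vars_stateCircuit_subset _ hx)
          (.cons (fun _ hx => vars_stateCircuit_subset _ hx) .nil)⟩
    | _ => exact hw.elim
  · intro g hg g₁ g₂ h₁ h₂ hne ν ⟨hν₁, hν₂⟩
    change StateGate.kind g = _ at hg
    change StateGate.Wire code f g₁ g at h₁
    change StateGate.Wire code f g₂ g at h₂
    cases g <;> simp only [StateGate.kind, reduceCtorEq] at hg
    · rename_i n k
      obtain ⟨n, hn⟩ := n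
      cases g₁ with
      | var x =>
        cases g₂ with
        | var y => exact hne (by cases h₁.1.symm.trans h₂.1; rfl)
        | neg y =>
          cases h₁.1.symm.trans h₂.1
          have h3 := (eval_state_neg ν x).1 hν₂
          rw [← eval_state_var (T := T) (code := code) (f := f) ν x, hν₁] at h3
          cases h3
        | pair m i j =>
          obtain ⟨-, l, r, h, -⟩ := h₂
          cases h₁.1.symm.trans h
        | _ => exact h₂.elim
      | neg x =>
        cases g₂ with
        | var y =>
          cases h₁.1.symm.trans h₂.1
          have h3 := (eval_state_neg ν x).1 hν₁
          rw [← eval_state_var (T := T) (code := code) (f := f) ν x, hν₂] at h3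
          cases h3
        | neg y => exact hne (by cases h₁.1.symm.trans h₂.1; rfl)
        | pair m i j =>
          obtain ⟨-, l, r, h, -⟩ := h₂
          cases h₁.1.symm.trans h
        | _ => exact h₂.elim
      | pair m i j =>
        obtain ⟨rfl, l, r, h, -⟩ := h₁
        cases g₂ with
        | var y => cases h.symm.trans h₂.1
        | neg y => cases h.symm.trans h₂.1
        | pair m' i' j' =>
          obtain ⟨rfl, -⟩ := h₂
          cases h
          obtain ⟨rfl, rfl⟩ := eval_pair hcode hT ν hn hν₁
          obtain ⟨rfl, rfl⟩ := eval_pair hcode hT ν hn hν₂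
          exact hne rfl
        | _ => exact h₂.elim
      | _ => exact h₁.elim
    · cases g₁ with
      | state m₁ k₁ =>
        cases g₂ with
        | state m₂ k₂ =>
          obtain ⟨m₁, hm₁⟩ := m₁
          obtain ⟨m₂, hm₂⟩ := m₂
          obtain rfl : m₁ = m₂ := h₁.1.trans h₂.1.symm
          have h3 := (eval_state hcode hT ν _ hm₁ k₁).1 hν₁
          have h4 := (eval_state hcode hT ν _ hm₁ k₂).1 hν₂
          exact hne (by rw [← h3, ← h4])
        | _ => exact h₂.elim
      | _ => exact h₁.elim

end

end StateCircuit

/-! ### Few subfunctions along every cut -/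

section Subfunctions

variable {V : Type u}

/-- A full v-tree has fewer than `2 * |V|` nodes, so there are at most `6 * |V| * N ^ 2` gates; each
contributes itself and at most `N ^ 2 + 2` wires, in total at most `4 * N ^ 2`. -/
theorem size_stateCircuit_le [Fintype V] {T : VTree V} {N : ℕ} (hN : 0 < N) (hT : T.IsFull)
    (hT' : T.IsOver) (code : VTree V → (V → Bool) → Fin N) (f : (V → Bool) → Prop) :
    (stateCircuit T code f).size ≤ 24 * Fintype.card V * N ^ 4 := by
  classical
  have h1 := (stateCircuit T code f).size_le_of_fanIn (L := (Fin N × Fin N) ⊕ Bool)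
    (StateGate.exists_inputs code f)
  have h2 : Nat.card (stateCircuit T code f).Gate ≤ _ := StateGate.card_le (T := T) (N := N)
  have h3 : Fintype.card T.Node + 1 ≤ 2 * Fintype.card V := by
    have hnode : Fintype.card T.Node ≤ T.nodes.length := by
      rw [Fintype.card_of_subtype T.nodes.toFinset (by simp)]
      exact T.nodes.toFinset_card_le
    have hleaves : T.leaves.length ≤ Fintype.card V := hT'.1.length_le_card
    have := hT.length_nodes
    omega
  simp only [Fintype.card_sum, Fintype.card_prod, Fintype.card_fin, Fintype.card_bool] at h1
  set t := Fintype.card T.Node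
  set v := Fintype.card V
  have hNN : N ≤ N * N := Nat.le_mul_self N
  have h4 : 2 * v + (t * N + t * (N * N) + 1) ≤ 6 * v * (N * N) := by
    have : t * N + 1 ≤ 2 * v * N := by nlinarith
    nlinarith
  have h5 : N * N + 2 + 1 ≤ 4 * (N * N) := by nlinarith
  calc _ ≤ _ := h1
    _ ≤ (6 * v * (N * N)) * (4 * (N * N)) := Nat.mul_le_mul (h2.trans h4) h5
    _ = _ := by ring

theorem glue_union {A B U : Finset V}
    (hU : ∀ x, x ∈ U ↔ x ∈ A ∨ x ∈ B) (ν μ : V → Bool) :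
    glue U ν μ = glue A ν (glue B ν μ) ∧ glue U ν μ = glue B ν (glue A ν μ) := by
  constructor <;> funext x <;> by_cases h1 : x ∈ A <;> by_cases h2 : x ∈ B <;>
    simp [glue, h1, h2, hU]

/-- A function that has few subfunctions at all cuts of a v-tree is computed by a small circuit. -/
theorem exists_circuit_of_subfunctions [Fintype V] {T : VTree V} {N : ℕ} (hT : T.IsFull)
    (hT' : T.IsOver) (f : (V → Bool) → Prop)
    (h : ∀ n ∈ T.nodes, ∃ σ : (V → Bool) → Fin N, ∀ ν ν', σ ν = σ ν' →
      ∀ μ, f (glue n.leafSet ν μ) → f (glue n.leafSet ν' μ)) :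
    ∃ C : Circuit V, C.IsDSDNNF ∧ C.Captures f ∧ C.size ≤ 24 * Fintype.card V * N ^ 4 := by
  classical
  have hN : 0 < N := by
    obtain ⟨σ, -⟩ := h T T.self_mem_nodes
    exact (σ fun _ => true).pos
  have hex : ∀ n : VTree V, ∃ σ : (V → Bool) → Fin N, n ∈ T.nodes → ∀ ν ν', σ ν = σ ν' →
      ∀ μ, f (glue n.leafSet ν μ) → f (glue n.leafSet ν' μ) := by
    intro n
    by_cases hn : n ∈ T.nodes
    · obtain ⟨σ, hσ⟩ := h n hn
      exact ⟨σ, fun _ => hσ⟩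
    · exact ⟨fun _ => ⟨0, hN⟩, fun h => (hn h).elim⟩
  choose σ hσ using hex
  set sub : VTree V → (V → Bool) → (V → Bool) → Prop := fun n ν μ => f (glue n.leafSet ν μ)
    with hsub
  have : Nonempty (V → Bool) := ⟨fun _ => true⟩
  -- Equal subfunctions may have different values of `σ`. Applying `σ` to a canonical representative
  -- makes the code depend exactly on the subfunction, as composing the states of the children
  -- requires.
  set code : VTree V → (V → Bool) → Fin N := fun n ν => σ n (Function.invFun (sub n) (sub n ν))
    with hcode
  have hinv : ∀ n ν, sub n (Function.invFun (sub n) (sub n ν)) = sub n ν :=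
    fun n ν => Function.invFun_eq ⟨ν, rfl⟩
  have code_iff : ∀ n ∈ T.nodes, ∀ ν ν', code n ν = code n ν' ↔ sub n ν = sub n ν' := by
    intro n hn ν ν'
    constructor
    · intro h
      rw [← hinv n ν, ← hinv n ν']
      funext μ
      exact propext ⟨hσ n hn _ _ h μ, hσ n hn _ _ h.symm μ⟩
    · intro h
      simp only [hcode, h]
  have hC : IsCode T code f := by
    refine ⟨fun x hx ν μ h => ?_, fun l r hn ν μ hl hr => ?_, fun ν μ h => ?_⟩
    · rw [code_iff _ hx]
      funext ξ
      have : glue (VTree.leaf x).leafSet ν ξ = glue (VTree.leaf x).leafSet μ ξ := by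
        funext y
        by_cases hy : y = x
        · simp [glue, VTree.leaves, hy, h]
        · simp [glue, VTree.leaves, hy]
      simp only [hsub, this]
    · have hl' : l ∈ T.nodes :=
        VTree.nodes_trans hn (VTree.children_subset_nodes (by simp [VTree.children]))
      have hr' : r ∈ T.nodes :=
        VTree.nodes_trans hn (VTree.children_subset_nodes (by simp [VTree.children]))
      rw [code_iff _ hl'] at hl
      rw [code_iff _ hr'] at hr
      rw [code_iff _ hn]
      have hd := leaves_disjoint_of_binary hT' hn
      have hU := fun ν μ => glue_union (A := l.leafSet) (B := r.leafSet)
        (U := (VTree.binary l r).leafSet) (by simp [VTree.leaves]) ν μ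
      have hswap : ∀ ξ, glue l.leafSet μ (glue r.leafSet ν ξ) =
          glue r.leafSet ν (glue l.leafSet μ ξ) := by
        intro ξ
        funext x
        by_cases h1 : x ∈ l.leaves
        · have h2 : x ∉ r.leaves := fun h2 => hd h1 h2
          simp [glue, h1, h2]
        · simp [glue, h1]
      funext ξ
      -- Replace `ν` by `μ` first on the leaves of `l`, treating those of `r` as part of the
      -- context, and then on the leaves of `r`.
      calc sub (.binary l r) ν ξ = sub l ν (glue r.leafSet ν ξ) := by
            simp only [hsub, (hU ν ξ).1]
        _ = sub l μ (glue r.leafSet ν ξ) := by rw [hl]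
        _ = sub r ν (glue l.leafSet μ ξ) := by simp only [hsub, hswap]
        _ = sub r μ (glue l.leafSet μ ξ) := by rw [hr]
        _ = sub (.binary l r) μ ξ := by simp only [hsub, (hU μ ξ).2]
    · rw [code_iff _ T.self_mem_nodes] at h
      have hall : ∀ ν, glue T.leafSet ν ν = ν := by
        intro ν; funext x; simp [glue]
      have hall' : glue T.leafSet μ ν = μ := by
        funext x; simp [glue, hT'.2 x]
      have := congrFun h ν
      simp only [hsub, hall, hall'] at this
      exact iff_of_eq this
  exact ⟨stateCircuit T code f, isDSDNNF_stateCircuit hC hT hT', captures_stateCircuit hC hT,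
    size_stateCircuit_le hN hT hT' code f⟩

theorem exists_signature {S : Type*} {F : Finset S} {M : ℕ} (hF : F.card ≤ M)
    (p : (V → Bool) → S → Prop) (q : (V → Bool) → Prop) :
    ∃ σ : (V → Bool) → Fin (2 ^ (M + 1)), ∀ ν ν', σ ν = σ ν' →
      (∀ e ∈ F, p ν e ↔ p ν' e) ∧ (q ν ↔ q ν') := by
  classical
  have hcard : Fintype.card ((F → Bool) × Bool) ≤ Fintype.card (Fin (2 ^ (M + 1))) := by
    simp only [Fintype.card_prod, Fintype.card_fun, Fintype.card_bool, Fintype.card_coe,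
      Fintype.card_fin, pow_succ]
    exact Nat.mul_le_mul_right _ (Nat.pow_le_pow_right (by norm_num) hF)
  obtain ⟨ι⟩ := Function.Embedding.nonempty_of_card_le hcard
  refine ⟨fun ν => ι (fun e => decide (p ν e), decide (q ν)), fun ν ν' h => ?_⟩
  have h := ι.injective h
  rw [Prod.mk.injEq] at h
  refine ⟨fun e he => ?_, by simpa using h.2⟩
  simpa using congrFun h.1 ⟨e, he⟩

/-- For each crossing clause, record whether it is already satisfied inside `A`; for the clauses
contained in `A`, one bit records whether all are satisfied. Clauses disjoint from `A` do not see
`ν`. -/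
theorem exists_signature_cnf (φ : MonotoneFormula V) (A : Finset V) {M : ℕ}
    (hM : (φ.crossing A).card ≤ M) :
    ∃ σ : (V → Bool) → Fin (2 ^ (M + 1)), ∀ ν ν', σ ν = σ ν' →
      ∀ μ, φ.CNFTrue (glue A ν μ) → φ.CNFTrue (glue A ν' μ) := by
  obtain ⟨σ, hσ⟩ := exists_signature hM (fun (ν : V → Bool) e => ∃ x ∈ e, x ∈ A ∧ ν x = true)
    (fun ν => ∀ e ∈ φ.clauses, (∀ x ∈ e, x ∈ A) → ∃ x ∈ e, ν x = true)
  refine ⟨σ, fun ν ν' h μ hf e he => ?_⟩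
  obtain ⟨h1, h2⟩ := hσ ν ν' h
  by_cases hin : ∀ x ∈ e, x ∈ A
  · have : ∃ x ∈ e, ν' x = true := by
      refine h2.1 (fun e he hin => ?_) e he hin
      obtain ⟨x, hx, hν⟩ := hf e he
      exact ⟨x, hx, by rwa [glue_of_mem (hin x hx)] at hν⟩
    obtain ⟨x, hx, hν⟩ := this
    exact ⟨x, hx, by rwa [glue_of_mem (hin x hx)]⟩
  · push Not at hin
    obtain ⟨x, hx, hν⟩ := hf e he
    by_cases hxA : x ∈ A
    · rw [glue_of_mem hxA] at hν
      obtain ⟨y, hy, hyA, hν'⟩ :=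
        (h1 e (MonotoneFormula.mem_crossing.2 ⟨he, ⟨x, hx, hxA⟩, hin⟩)).1 ⟨x, hx, hxA, hν⟩
      exact ⟨y, hy, by rwa [glue_of_mem hyA]⟩
    · rw [glue_of_notMem hxA] at hν
      exact ⟨x, hx, by rwa [glue_of_notMem hxA]⟩

/-- Dually, record which crossing clauses are not yet falsified inside `A`, and whether some clause
contained in `A` is satisfied. -/
theorem exists_signature_dnf (φ : MonotoneFormula V) (A : Finset V) {M : ℕ}
    (hM : (φ.crossing A).card ≤ M) :
    ∃ σ : (V → Bool) → Fin (2 ^ (M + 1)), ∀ ν ν', σ ν = σ ν' →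
      ∀ μ, φ.DNFTrue (glue A ν μ) → φ.DNFTrue (glue A ν' μ) := by
  obtain ⟨σ, hσ⟩ := exists_signature hM (fun (ν : V → Bool) e => ∀ x ∈ e, x ∈ A → ν x = true)
    (fun ν => ∃ e ∈ φ.clauses, (∀ x ∈ e, x ∈ A) ∧ ∀ x ∈ e, ν x = true)
  refine ⟨σ, fun ν ν' h μ ⟨e, he, hf⟩ => ?_⟩
  obtain ⟨h1, h2⟩ := hσ ν ν' h
  by_cases hin : ∀ x ∈ e, x ∈ A
  · obtain ⟨e', he', hin', h'⟩ := h2.1 ⟨e, he, hin, fun x hx => by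
      have := hf x hx; rwa [glue_of_mem (hin x hx)] at this⟩
    exact ⟨e', he', fun x hx => by rw [glue_of_mem (hin' x hx)]; exact h' x hx⟩
  · refine ⟨e, he, fun x hx => ?_⟩
    by_cases hxA : x ∈ A
    · rw [glue_of_mem hxA]
      push Not at hin
      refine (h1 e (MonotoneFormula.mem_crossing.2 ⟨he, ⟨x, hx, hxA⟩, hin⟩)).1 ?_ x hx hxA
      intro y hy hyA
      have := hf y hy
      rwa [glue_of_mem hyA] at this
    · have := hf x hx
      rw [glue_of_notMem hxA] at this ⊢
      exact this

theorem upper_bound_of_signature [Fintype V] {φ : MonotoneFormula V} {c : ℕ} (hdeg : φ.degree ≤ c)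
    (f : (V → Bool) → Prop)
    (hf : ∀ (A : Finset V) (M : ℕ), (φ.crossing A).card ≤ M →
      ∃ σ : (V → Bool) → Fin (2 ^ (M + 1)), ∀ ν ν', σ ν = σ ν' →
        ∀ μ, f (glue A ν μ) → f (glue A ν' μ)) :
    ∃ C : Circuit V, C.IsDSDNNF ∧ C.Captures f ∧
      C.size ≤ φ.size * 2 ^ ((4 * c + 9) * (φ.treewidth + 1)) := by
  obtain ⟨D, hD⟩ := exists_width_eq_treewidth φ
  obtain ⟨T, h1, h2, h3⟩ := exists_vtree D
  rw [hD] at h3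
  obtain ⟨C, hC1, hC2, hC3⟩ := exists_circuit_of_subfunctions h1 h2 f
    fun n hn => hf n.leafSet _ ((h3 n hn).trans (Nat.mul_le_mul_left _ hdeg))
  refine ⟨C, hC1, hC2, hC3.trans ?_⟩
  set k := φ.treewidth
  have hsize : Fintype.card V ≤ φ.size := Nat.le_add_right _ _
  -- With `24 ≤ 2 ^ 5` the exponent is `5 + 4 * ((k + 1) * c + 1) = 4 * c * (k + 1) + 9`, whence the
  -- constant `4 * c + 9`.
  calc 24 * Fintype.card V * (2 ^ ((k + 1) * c + 1)) ^ 4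
      ≤ 2 ^ 5 * φ.size * (2 ^ ((k + 1) * c + 1)) ^ 4 := by gcongr; norm_num
    _ = φ.size * 2 ^ (5 + ((k + 1) * c + 1) * 4) := by rw [pow_add, pow_mul]; ring
    _ ≤ φ.size * 2 ^ ((4 * c + 9) * (k + 1)) := by
      gcongr
      · norm_num
      · nlinarith

end Subfunctions

/-! ### Lower bounds for structured circuits -/

namespace Circuit

variable {V : Type u} {C : Circuit V}

theorem vars_subset_of_wire {g' g : C.Gate} (h : C.wire g' g) : C.vars g' ⊆ C.vars g :=
  fun _ ⟨g₀, h₀, hp⟩ => ⟨g₀, h₀, hp.tail h⟩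

theorem exists_wire_of_mem_vars {g : C.Gate} (hg : ∀ x, C.kind g ≠ .var x) {x : V}
    (hx : x ∈ C.vars g) : ∃ g', C.wire g' g ∧ x ∈ C.vars g' := by
  obtain ⟨g₀, h₀, hp⟩ := hx
  rcases Relation.ReflTransGen.cases_tail hp with h | ⟨g', h1, h2⟩
  · exact (hg x (h ▸ h₀)).elim
  · exact ⟨g', h2, g₀, h₀, h1⟩

theorem eq_of_mem_vars_of_var {g : C.Gate} {y : V} (hg : C.kind g = .var y) {x : V}
    (hx : x ∈ C.vars g) : x = y := by
  obtain ⟨g₀, h₀, hp⟩ := hx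
  rcases Relation.ReflTransGen.cases_tail hp with h | ⟨g', -, h2⟩
  · rw [← h, hg] at h₀
    cases h₀
    rfl
  · exact (C.var_fanIn g y hg g' h2).elim

theorem eval_congr {ν ν' : V → Bool} (g : C.Gate) (h : ∀ x ∈ C.vars g, ν x = ν' x) :
    C.eval ν g = C.eval ν' g := by
  induction g using C.wire_wellFounded.induction with
  | _ g ih =>
    have ih' : ∀ g', C.wire g' g → C.eval ν g' = C.eval ν' g' :=
      fun g' hw => ih g' hw fun x hx => h x (vars_subset_of_wire hw hx)
    cases hk : C.kind g with
    | var x =>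
      rw [C.eval_var hk, C.eval_var hk]
      exact h x ⟨g, hk, .refl⟩
    | not =>
      rw [Bool.eq_iff_iff, C.eval_not hk, C.eval_not hk]
      exact exists_congr fun g' => and_congr_right fun hw => by rw [ih' g' hw]
    | or =>
      rw [Bool.eq_iff_iff, C.eval_or hk, C.eval_or hk]
      exact exists_congr fun g' => and_congr_right fun hw => by rw [ih' g' hw]
    | and =>
      rw [Bool.eq_iff_iff, C.eval_and hk, C.eval_and hk]
      exact forall_congr' fun g' => forall_congr' fun hw => by rw [ih' g' hw]

/-- The gates of a structured circuit, seen from a cut of its v-tree. -/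
inductive CutCase (C : Circuit V) (A : Finset V) (g : C.Gate) : Prop
  | inside (h : ∀ x ∈ C.vars g, x ∈ A)
  | outside (h : ∀ x ∈ C.vars g, x ∉ A)
  | or (h : C.kind g = .or)
  | and (g₁ : C.Gate) (hw : C.wire g₁ g) (p : (V → Bool) → Bool)
      (hp : ∀ ν ν' μ, p (glue A ν μ) = p (glue A ν' μ))
      (h : ∀ ν, C.eval ν g = (C.eval ν g₁ && p ν))

theorem eval_glue_of_outside {A : Finset V} {g : C.Gate} (h : ∀ x ∈ C.vars g, x ∉ A)
    (ν ν' μ : V → Bool) : C.eval (glue A ν μ) g = C.eval (glue A ν' μ) g :=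
  eval_congr g fun x hx => by rw [glue_of_notMem (h x hx), glue_of_notMem (h x hx)]

/-- Literals have a single variable. For a binary AND, compare `n` with the node `m` structuring the
gate: if `m` is below `n` or disjoint from it, the gate is on one side; if `n` is strictly below
`m`, it is below one child of `m`, and the input attached to the other child ignores the leaves of
`n`. -/
theorem cutCase (hC : C.IsNNF) {T : VTree V} (hT : C.IsStructuredBy T) {n : VTree V}
    (hn : n ∈ T.nodes) (g : C.Gate) : CutCase C n.leafSet g := by
  classical
  have single : ∀ y, (∀ x ∈ C.vars g, x = y) → CutCase C n.leafSet g := by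
    intro y h
    by_cases hy : y ∈ n.leafSet
    · exact .inside fun x hx => h x hx ▸ hy
    · exact .outside fun x hx => h x hx ▸ hy
  cases hk : C.kind g with
  | var y => exact single y fun x hx => eq_of_mem_vars_of_var hk hx
  | or => exact .or hk
  | not =>
    obtain ⟨g', hw, huniq⟩ := C.not_fanIn g hk
    obtain ⟨y, hy⟩ := hC g hk g' hw
    refine single y fun x hx => ?_
    obtain ⟨g'', hw', hx'⟩ := exists_wire_of_mem_vars (by simp [hk]) hx
    rw [huniq g'' hw'] at hx'
    exact eq_of_mem_vars_of_var hy hx'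
  | and =>
    have hnv : ∀ x, C.kind g ≠ .var x := by simp [hk]
    by_cases hin : ∃ g', C.wire g' g
    · obtain ⟨m, hm, inputs, -, hmem, hall⟩ := hT.2 g hk hin
      cases m with
      | leaf y =>
        cases hall
        obtain ⟨g', hw⟩ := hin
        simpa using (hmem g').2 hw
      | unary t =>
        obtain ⟨g₁, l, -, hl, rfl⟩ := List.forall₂_cons_right_iff.1 hall
        obtain rfl := List.forall₂_nil_right_iff.1 hl
        refine .and g₁ ((hmem g₁).1 (by simp)) (fun _ => true) (fun _ _ _ => rfl) fun ν => ?_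
        rw [Bool.eq_iff_iff, C.eval_and hk]
        simp [← hmem]
      | binary l r =>
        obtain ⟨g₁, l₁, h₁, hl, rfl⟩ := List.forall₂_cons_right_iff.1 hall
        obtain ⟨g₂, l₂, h₂, hl', rfl⟩ := List.forall₂_cons_right_iff.1 hl
        obtain rfl := List.forall₂_nil_right_iff.1 hl'
        have heval : ∀ ν, C.eval ν g = (C.eval ν g₁ && C.eval ν g₂) := by
          intro ν
          rw [Bool.eq_iff_iff, C.eval_and hk]
          simp [← hmem]
        have hvars : ∀ x ∈ C.vars g, x ∈ (VTree.binary l r).leaves := by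
          intro x hx
          obtain ⟨g', hw, hx'⟩ := exists_wire_of_mem_vars hnv hx
          rw [← hmem, List.mem_cons, List.mem_singleton] at hw
          rw [VTree.leaves, List.mem_append]
          rcases hw with rfl | rfl
          · exact .inl (h₁ x hx')
          · exact .inr (h₂ x hx')
        by_cases hmeet : ∃ x ∈ (VTree.binary l r).leaves, x ∈ n.leaves
        · obtain ⟨x, hxm, hxn⟩ := hmeet
          have hsub : VTree.binary l r ∈ n.nodes → CutCase C n.leafSet g := fun h =>
            .inside fun x hx =>
              VTree.mem_leafSet.2 (VTree.leaves_subset_of_mem_nodes h (hvars x hx))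
          rcases VTree.mem_nodes_or_mem_nodes hT.1.1 hn hm hxn hxm with h | h
          · by_cases hne : n = .binary l r
            · exact hsub (hne ▸ VTree.self_mem_nodes _)
            obtain ⟨c, hc, hnc⟩ := VTree.exists_child_of_mem_nodes h hne
            have hd := leaves_disjoint_of_binary hT.1 hm
            have hcn := VTree.leaves_subset_of_mem_nodes hnc
            simp only [VTree.children, List.mem_cons, List.not_mem_nil, or_false] at hc
            rcases hc with rfl | rfl
            · refine .and g₁ ((hmem g₁).1 (by simp)) (fun ν => C.eval ν g₂)
                (eval_glue_of_outside fun x hx hxn => ?_) heval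
              exact hd (hcn (VTree.mem_leafSet.1 hxn)) (h₂ x hx)
            · refine .and g₂ ((hmem g₂).1 (by simp)) (fun ν => C.eval ν g₁)
                (eval_glue_of_outside fun x hx hxn => ?_)
                (fun ν => (heval ν).trans (Bool.and_comm _ _))
              exact hd (h₁ x hx) (hcn (VTree.mem_leafSet.1 hxn))
          · exact hsub h
        · exact .outside fun x hx hxn => hmeet ⟨x, hvars x hx, VTree.mem_leafSet.1 hxn⟩
    · exact .inside fun x hx =>
        (hin ((exists_wire_of_mem_vars hnv hx).imp fun _ h => h.1)).elim

/-- The models of a gate of an SDNNF at a fixed valuation of one side of a cut are a union of models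
of gates. -/
theorem exists_gate_of_eval (hC : C.IsNNF) {T : VTree V} (hT : C.IsStructuredBy T) {n : VTree V}
    (hn : n ∈ T.nodes) (g : C.Gate) (α β : V → Bool)
    (h : C.eval (glue n.leafSet α β) g = true) :
    ∃ h : Option C.Gate, (∀ h' ∈ h, C.eval α h' = true) ∧
      ∀ α', (∀ h' ∈ h, C.eval α' h' = true) → C.eval (glue n.leafSet α' β) g = true := by
  -- Descend to a true input at an OR, and to `g₁` at an AND, until the gate lies on one side. A
  -- gate outside of the cut gives no condition on `α`, which is encoded by `none`.
  induction g using C.wire_wellFounded.induction with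
  | _ g ih =>
    cases cutCase hC hT hn g with
    | inside hin =>
      have : ∀ α', C.eval (glue n.leafSet α' β) g = C.eval α' g := fun α' =>
        eval_congr g fun x hx => glue_of_mem (hin x hx)
      refine ⟨some g, ?_, ?_⟩
      · simpa [this] using h
      · simp [this]
    | outside hout =>
      exact ⟨none, by simp, fun α' _ => (eval_glue_of_outside hout α' α β).trans h⟩
    | or hk =>
      obtain ⟨g', hw, hg'⟩ := (C.eval_or hk _).1 h
      obtain ⟨w, h1, h2⟩ := ih g' hw hg'
      exact ⟨w, h1, fun α' hα' => (C.eval_or hk _).2 ⟨g', hw, h2 α' hα'⟩⟩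
    | and g₁ hw p hp heval =>
      rw [heval, Bool.and_eq_true] at h
      obtain ⟨w, h1, h2⟩ := ih g₁ hw h.1
      refine ⟨w, h1, fun α' hα' => ?_⟩
      rw [heval, Bool.and_eq_true, hp α' α]
      exact ⟨h2 α' hα', h.2⟩

/-- The `ℚ`-valued indicator function of the models of a gate. -/
noncomputable def indicator (C : Circuit V) (g : C.Gate) (ν : V → Bool) : ℚ :=
  if C.eval ν g = true then 1 else 0

/-- The indicator of a gate of a d-SDNNF at a fixed valuation of one side of a cut is a linear
combination of indicators of gates. -/
theorem indicator_glue_mem_span (hC : C.IsNNF) (hdet : C.IsDeterministic) {T : VTree V}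
    (hT : C.IsStructuredBy T) {n : VTree V} (hn : n ∈ T.nodes) (g : C.Gate) (β : V → Bool) :
    (fun α => C.indicator g (glue n.leafSet α β)) ∈
      Submodule.span ℚ (Set.range fun o : Option C.Gate => fun α => o.elim 1 (C.indicator · α)) := by
  classical
  have := Fintype.ofFinite C.Gate
  set W := Submodule.span ℚ
    (Set.range fun o : Option C.Gate => fun α => o.elim 1 (C.indicator · α)) with hW
  have hone : (fun _ => 1 : (V → Bool) → ℚ) ∈ W := Submodule.subset_span ⟨none, rfl⟩
  induction g using C.wire_wellFounded.induction with
  | _ g ih =>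
    cases cutCase hC hT hn g with
    | inside hin =>
      have : (fun α => C.indicator g (glue n.leafSet α β)) = fun α => C.indicator g α := by
        funext α
        rw [indicator, indicator, eval_congr g fun x hx => glue_of_mem (hin x hx)]
      rw [this]
      exact Submodule.subset_span ⟨some g, rfl⟩
    | outside hout =>
      have : (fun α => C.indicator g (glue n.leafSet α β)) =
          C.indicator g (glue n.leafSet β β) • (fun _ => 1 : (V → Bool) → ℚ) := by
        funext α
        simp [indicator, eval_glue_of_outside hout α β β]
      rw [this]
      exact W.smul_mem _ hone
    | or hk =>
      -- By determinism at most one input is true, so the indicator of the OR is the sum of those of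
      -- its inputs.
      have : (fun α => C.indicator g (glue n.leafSet α β)) =
          ∑ g' ∈ Finset.univ.filter (C.wire · g),
            fun α => C.indicator g' (glue n.leafSet α β) := by
        funext α
        rw [Finset.sum_apply]
        by_cases h : C.eval (glue n.leafSet α β) g = true
        · obtain ⟨g', hw, hg'⟩ := (C.eval_or hk _).1 h
          rw [Finset.sum_eq_single g']
          · simp [indicator, h, hg']
          · intro g'' hw' hne
            rw [indicator, if_neg]
            exact fun h' => hdet g hk g' g'' hw (Finset.mem_filter.1 hw').2 hne.symm _ ⟨hg', h'⟩
          · intro h'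
            exact (h' (by simpa using hw)).elim
        · rw [Finset.sum_eq_zero]
          · simp [indicator, h]
          · intro g' hw
            rw [indicator, if_neg]
            exact fun h' => h ((C.eval_or hk _).2 ⟨g', (Finset.mem_filter.1 hw).2, h'⟩)
      rw [this]
      exact W.sum_mem fun g' hw => ih g' (Finset.mem_filter.1 hw).2
    | and g₁ hw p hp heval =>
      have : (fun α => C.indicator g (glue n.leafSet α β)) =
          (if p (glue n.leafSet β β) then (1 : ℚ) else 0) •
            fun α => C.indicator g₁ (glue n.leafSet α β) := by
        funext α
        cases h : p (glue n.leafSet β β) <;> simp [indicator, heval, hp α β β, h]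
      rw [this]
      exact W.smul_mem _ (ih g₁ hw)

end Circuit

/-- The indicators of the power sets of the subsets of a finite type are linearly independent. -/
theorem linearIndependent_subset_indicator {ι : Type*} [Fintype ι] [DecidableEq ι] :
    LinearIndependent ℚ fun b : Finset ι => fun a : Finset ι => if a ⊆ b then (1 : ℚ) else 0 := by
  rw [Fintype.linearIndependent_iff]
  intro w hw a
  -- Downward induction on the size of `a`: evaluated at `a`, only supersets of `a` contribute, and
  -- the coefficients of the proper ones already vanish.
  induction h : Fintype.card ι - a.card using Nat.strong_induction_on generalizing a with
  | _ k ih =>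
    have h1 := congrFun hw a
    rw [Finset.sum_apply, Finset.sum_eq_single a] at h1
    · simpa using h1
    · intro b _ hb
      by_cases hab : a ⊆ b
      · have hlt := Finset.card_lt_card (hab.ssubset_of_ne hb.symm)
        have hle := Finset.card_le_univ b
        rw [ih _ (by omega) b rfl]
        simp
      · simp [hab]
    · simp

/-! ### Fooling sets and rank at a cut -/

section LowerBound

variable {V : Type u} {C : Circuit V}

/-- Let `w a` certify acceptance of the pair `(a, aᶜ)`. If `w a = w b`, then `(a, bᶜ)` and `(b, aᶜ)`
are accepted too, so `a ⊆ b ⊆ a`. Thus `w` is injective into `Option C.Gate`. -/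
theorem pow_le_of_fooling {ι : Type*} [Fintype ι] [DecidableEq ι] (hC : C.IsNNF) {T : VTree V}
    (hT : C.IsStructuredBy T) {n : VTree V} (hn : n ∈ T.nodes) (α β : Finset ι → V → Bool)
    (h : ∀ a b, C.eval (glue n.leafSet (α a) (β b)) C.output = true ↔ Disjoint a b) :
    2 ^ Fintype.card ι ≤ Nat.card C.Gate + 1 := by
  choose w hw1 hw2 using fun a : Finset ι =>
    Circuit.exists_gate_of_eval hC hT hn C.output (α a) (β aᶜ) ((h _ _).2 disjoint_compl_right)
  have hsub : ∀ a b, w a = w b → a ⊆ b := by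
    intro a b hab
    have := (h a bᶜ).1 (hw2 b (α a) (hab ▸ hw1 a))
    rwa [disjoint_compl_right_iff] at this
  have hinj : Function.Injective w := fun a b hab => (hsub a b hab).antisymm (hsub b a hab.symm)
  have := Nat.card_le_card_of_injective _ hinj
  rwa [Nat.card_eq_fintype_card, Fintype.card_finset, Finite.card_option] at this

/-- The all-ones matrix minus the matrix of the pairs `(a, bᶜ)` is the inclusion matrix, of rank `2
^ |ι|`. Its columns lie in the span of the constant `1` and the indicators of the gates. -/
theorem pow_le_of_rank {ι : Type*} [Fintype ι] [DecidableEq ι] (hC : C.IsNNF)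
    (hdet : C.IsDeterministic) {T : VTree V} (hT : C.IsStructuredBy T) {n : VTree V}
    (hn : n ∈ T.nodes) (α β : Finset ι → V → Bool)
    (h : ∀ a b, C.eval (glue n.leafSet (α a) (β b)) C.output = true ↔ ¬ Disjoint a b) :
    2 ^ Fintype.card ι ≤ Nat.card C.Gate + 1 := by
  have := Fintype.ofFinite C.Gate
  set F : Option C.Gate → Finset ι → ℚ := fun o a => o.elim 1 (C.indicator · (α a)) with hF
  have hone : (fun _ => 1 : Finset ι → ℚ) ∈ Submodule.span ℚ (Set.range F) :=
    Submodule.subset_span ⟨none, rfl⟩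
  have hmem : ∀ b : Finset ι, (fun a => if a ⊆ b then (1 : ℚ) else 0) ∈
      Submodule.span ℚ (Set.range F) := by
    intro b
    have h1 := Circuit.indicator_glue_mem_span hC hdet hT hn C.output (β bᶜ)
    have h2 := Submodule.mem_map_of_mem (f := LinearMap.funLeft ℚ ℚ α) h1
    rw [Submodule.map_span, ← Set.range_comp] at h2
    have h3 := Submodule.sub_mem _ hone h2
    convert h3 using 1
    funext a
    have := h a bᶜ
    rw [disjoint_compl_right_iff] at this
    by_cases hab : a ⊆ b <;> simp [LinearMap.funLeft, Circuit.indicator, this, hab]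
  have hli := linearIndependent_subset_indicator (ι := ι)
  have h1 := linearIndependent_iff_card_eq_finrank_span.1 hli
  have h2 : Submodule.span ℚ (Set.range fun b : Finset ι => fun a : Finset ι =>
      if a ⊆ b then (1 : ℚ) else 0) ≤ Submodule.span ℚ (Set.range F) := by
    rw [Submodule.span_le]
    rintro _ ⟨b, rfl⟩
    exact hmem b
  have h3 := Submodule.finrank_mono h2
  have h4 := finrank_range_le_card (R := ℚ) F
  rw [Fintype.card_option] at h4
  rw [Set.finrank] at h1 h4
  rw [Nat.card_eq_fintype_card, ← Fintype.card_finset, h1]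
  exact h3.trans h4

end LowerBound

/-! ### Independent crossing clauses -/

/-- An independent set of maximal size dominates `s`, so its neighbourhoods, each of size at most
`D`, cover `s`. -/
theorem exists_independent {ι : Type*} [DecidableEq ι] (R : ι → ι → Prop) [DecidableRel R]
    (hrefl : ∀ a, R a a) (hsymm : ∀ a b, R a b → R b a) (s : Finset ι) {D : ℕ}
    (hD : ∀ a ∈ s, (s.filter (R a)).card ≤ D) :
    ∃ t ⊆ s, (∀ a ∈ t, ∀ b ∈ t, R a b → a = b) ∧ s.card ≤ t.card * D := by
  obtain ⟨t, ht, hmax⟩ := Finset.exists_max_image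
    (s.powerset.filter fun t => ∀ a ∈ t, ∀ b ∈ t, R a b → a = b) Finset.card ⟨∅, by simp⟩
  simp only [Finset.mem_filter, Finset.mem_powerset] at ht hmax
  refine ⟨t, ht.1, ht.2, ?_⟩
  have hcover : s ⊆ t.biUnion fun a => s.filter (R a) := by
    intro b hb
    by_contra hno
    simp only [Finset.mem_biUnion, Finset.mem_filter, not_exists, not_and] at hno
    have hfar : ∀ a ∈ t, ¬ R a b := fun a ha => hno a ha hb
    have hbt : b ∉ t := fun h => hfar b h (hrefl b)
    have := hmax (insert b t) ⟨Finset.insert_subset hb ht.1, ?_⟩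
    · rw [Finset.card_insert_of_notMem hbt] at this
      omega
    · intro x hx y hy hxy
      rw [Finset.mem_insert] at hx hy
      rcases hx with rfl | hx <;> rcases hy with rfl | hy
      · rfl
      · exact (hfar y hy (hsymm _ _ hxy)).elim
      · exact (hfar x hx hxy).elim
      · exact ht.2 x hx y hy hxy
  exact (Finset.card_le_card hcover).trans
    (Finset.card_biUnion_le_card_mul _ _ _ fun a ha => hD a (ht.1 ha))

section Independent

variable {V : Type u} {φ : MonotoneFormula V}

/-- Two clauses are linked if some clause meets both of them. -/
def Linked (φ : MonotoneFormula V) (e e' : Finset V) : Prop :=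
  ∃ d ∈ φ.clauses, (∃ x ∈ d, x ∈ e) ∧ ∃ x ∈ d, x ∈ e'

open Classical in
theorem card_linked_le [Fintype V] {c : ℕ} (har : φ.arity ≤ c) (hdeg : φ.degree ≤ c)
    {e : Finset V} (he : e ∈ φ.clauses) : (φ.clauses.filter (Linked φ e)).card ≤ c ^ 4 := by
  have hmeet : ∀ d ∈ φ.clauses, (φ.clauses.filter fun d' => ∃ x ∈ d', x ∈ d).card ≤ c * c :=
    fun d hd => (φ.card_filter_meet_le d).trans
      (Nat.mul_le_mul ((MonotoneFormula.card_le_arity hd).trans har) hdeg)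
  have hsub : φ.clauses.filter (Linked φ e) ⊆
      (φ.clauses.filter fun d => ∃ x ∈ d, x ∈ e).biUnion
        fun d => φ.clauses.filter fun e' => ∃ x ∈ e', x ∈ d := by
    intro e' he'
    obtain ⟨he', d, hd, h1, x, hx, hx'⟩ := Finset.mem_filter.1 he'
    exact Finset.mem_biUnion.2 ⟨d, Finset.mem_filter.2 ⟨hd, h1⟩,
      Finset.mem_filter.2 ⟨he', x, hx', hx⟩⟩
  calc _ ≤ _ := Finset.card_le_card hsub
    _ ≤ _ := Finset.card_biUnion_le_card_mul _ _ (c * c)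
      fun d hd => hmeet d (Finset.mem_filter.1 hd).1
    _ ≤ (c * c) * (c * c) := Nat.mul_le_mul_right _ (hmeet e he)
    _ = c ^ 4 := by ring

theorem exists_independent_crossing [Fintype V] {c : ℕ} (har : φ.arity ≤ c) (hdeg : φ.degree ≤ c)
    (A : Finset V) : ∃ E ⊆ φ.crossing A, (∀ e ∈ E, ∀ e' ∈ E, Linked φ e e' → e = e') ∧
      (φ.crossing A).card ≤ E.card * c ^ 4 := by
  classical
  have hcl : φ.crossing A ⊆ φ.clauses := fun e he => (MonotoneFormula.mem_crossing.1 he).1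
  have hR : ∀ e ∈ φ.crossing A, ((φ.crossing A).filter fun e' => e = e' ∨ Linked φ e e').card ≤
      c ^ 4 := by
    intro e he
    refine (Finset.card_le_card fun e' he' => ?_).trans (card_linked_le har hdeg (hcl he))
    obtain ⟨h, h'⟩ := Finset.mem_filter.1 he'
    refine Finset.mem_filter.2 ⟨hcl h, ?_⟩
    rcases h' with rfl | h'
    · obtain ⟨x, hx⟩ := φ.clause_nonempty e (hcl he)
      exact ⟨e, hcl he, ⟨x, hx, hx⟩, x, hx, hx⟩
    · exact h'
  -- Equality is added because `Linked` is reflexive on clauses but not on arbitrary sets.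
  obtain ⟨E, h1, h2, h3⟩ := exists_independent (fun e e' => e = e' ∨ Linked φ e e')
    (fun _ => .inl rfl) (fun e e' h => h.imp Eq.symm fun ⟨d, hd, h, h'⟩ => ⟨d, hd, h', h⟩)
    (φ.crossing A) hR
  exact ⟨E, h1, fun e he e' he' h => h2 e he e' he' (.inr h), h3⟩

open Classical in
/-- The valuation that is false outside of the clauses of `E` and true on these clauses, except at
the variables `x e` for `e` not in `a`. -/
noncomputable def selectVal (E : Finset (Finset V)) (x : E → V) (a : Finset E) (v : V) : Bool :=
  decide ((∃ e ∈ E, v ∈ e) ∧ ∀ e : E, v = x e → e ∈ a)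

/-- A true clause lies in the union of `E`. It links all members of `E` that it meets, so it lies in
one of them and equals it by minimality. This clause is true exactly when `x e` and `y e` are, that
is, when `e` belongs to both `a` and `b`. -/
theorem dnfTrue_selectVal {A : Finset V} {E : Finset (Finset V)} (hE : E ⊆ φ.crossing A)
    (hind : ∀ e ∈ E, ∀ e' ∈ E, Linked φ e e' → e = e') {x y : E → V}
    (hx : ∀ e : E, x e ∈ e.1 ∧ x e ∈ A) (hy : ∀ e : E, y e ∈ e.1 ∧ y e ∉ A) (a b : Finset E) :
    φ.DNFTrue (glue A (selectVal E x a) (selectVal E y b)) ↔ ¬ Disjoint a b := by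
  classical
  have hcl : ∀ e ∈ E, e ∈ φ.clauses := fun e he => (MonotoneFormula.mem_crossing.1 (hE he)).1
  have huniq : ∀ v, ∀ e ∈ E, ∀ e' ∈ E, v ∈ e → v ∈ e' → e = e' := fun v e he e' he' hv hv' =>
    hind e he e' he' ⟨e, hcl e he, ⟨v, hv, hv⟩, v, hv, hv'⟩
  rw [Finset.not_disjoint_iff]
  constructor
  · rintro ⟨e, he, h⟩
    have hin : ∀ v ∈ e, ∃ e' ∈ E, v ∈ e' := by
      intro v hv
      have := h v hv
      by_cases hvA : v ∈ A
      · rw [glue_of_mem hvA, selectVal, decide_eq_true_eq] at this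
        exact this.1
      · rw [glue_of_notMem hvA, selectVal, decide_eq_true_eq] at this
        exact this.1
    obtain ⟨v₀, hv₀⟩ := φ.clause_nonempty e he
    obtain ⟨e₀, he₀, hve₀⟩ := hin v₀ hv₀
    have hsub : e ⊆ e₀ := by
      intro v hv
      obtain ⟨e₁, he₁, hve₁⟩ := hin v hv
      rwa [hind e₀ he₀ e₁ he₁ ⟨e, he, ⟨v₀, hv₀, hve₀⟩, v, hv, hve₁⟩]
    obtain rfl := φ.minimized e he e₀ (hcl e₀ he₀) hsub
    refine ⟨⟨e, he₀⟩, ?_, ?_⟩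
    · have hx' := hx ⟨e, he₀⟩
      have := h _ hx'.1
      rw [glue_of_mem hx'.2, selectVal, decide_eq_true_eq] at this
      exact this.2 _ rfl
    · have hy' := hy ⟨e, he₀⟩
      have := h _ hy'.1
      rw [glue_of_notMem hy'.2, selectVal, decide_eq_true_eq] at this
      exact this.2 _ rfl
  · rintro ⟨⟨e, he⟩, ha, hb⟩
    refine ⟨e, hcl e he, fun v hv => ?_⟩
    by_cases hvA : v ∈ A
    · rw [glue_of_mem hvA, selectVal, decide_eq_true_eq]
      refine ⟨⟨e, he, hv⟩, fun e' h => ?_⟩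
      have : e' = ⟨e, he⟩ := Subtype.ext (huniq v _ e'.2 _ he (h ▸ (hx e').1) hv)
      rwa [this]
    · rw [glue_of_notMem hvA, selectVal, decide_eq_true_eq]
      refine ⟨⟨e, he, hv⟩, fun e' h => ?_⟩
      have : e' = ⟨e, he⟩ := Subtype.ext (huniq v _ e'.2 _ he (h ▸ (hy e').1) hv)
      rwa [this]

/-- De Morgan duality: flipping all bits turns the hard DNF valuations into hard CNF valuations,
with disjointness in place of intersection. -/
theorem cnfTrue_iff_not_dnfTrue (ν : V → Bool) :
    φ.CNFTrue ν ↔ ¬ φ.DNFTrue fun v => !ν v := by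
  simp [MonotoneFormula.CNFTrue, MonotoneFormula.DNFTrue]

theorem not_glue (A : Finset V) (ν μ : V → Bool) :
    (fun v => !glue A (fun v => !ν v) (fun v => !μ v) v) = glue A ν μ := by
  funext v
  by_cases h : v ∈ A <;> simp [glue, h]

/-- A cut that maximizes the number of crossing clauses gives many independent clauses. -/
theorem exists_hard_cut [Fintype V] {c : ℕ} (har : φ.arity ≤ c) (hdeg : φ.degree ≤ c)
    {T : VTree V} (hT : T.IsOver) : ∃ n ∈ T.nodes, ∃ E : Finset (Finset V), ∃ x y : E → V,
      φ.treewidth ≤ 2 * c ^ 5 * E.card + c ^ 2 ∧ ∀ a b : Finset E,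
        φ.DNFTrue (glue n.leafSet (selectVal E x a) (selectVal E y b)) ↔ ¬ Disjoint a b := by
  classical
  obtain ⟨n, hn, hmax⟩ := Finset.exists_max_image T.nodes.toFinset
    (fun n => (φ.crossing n.leafSet).card) ⟨T, by simp [T.self_mem_nodes]⟩
  simp only [List.mem_toFinset] at hn hmax
  obtain ⟨E, hE, hind, hcard⟩ := exists_independent_crossing har hdeg n.leafSet
  have hex : ∀ e : E, (∃ v, v ∈ e.1 ∧ v ∈ n.leafSet) ∧ ∃ v, v ∈ e.1 ∧ v ∉ n.leafSet :=
    fun e => (MonotoneFormula.mem_crossing.1 (hE e.2)).2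
  choose x hx using fun e => (hex e).1
  choose y hy using fun e => (hex e).2
  refine ⟨n, hn, E, x, y, ?_, dnfTrue_selectVal hE hind hx hy⟩
  -- All cuts of `T` are at most the maximal one, so a large treewidth forces many crossing clauses
  -- there, and `E` keeps a `1 / c ^ 4` fraction of them.
  calc φ.treewidth ≤ (2 * (φ.crossing n.leafSet).card + φ.degree) * φ.arity :=
        treewidth_le_of_vtree φ hT hmax
    _ ≤ (2 * (E.card * c ^ 4) + c) * c := by gcongr
    _ = 2 * c ^ 5 * E.card + c ^ 2 := by ring

/-! ### From independent clauses to the exponential bound -/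

theorem card_vars_le_card_gate [Fintype V] (C : Circuit V) :
    Fintype.card V ≤ Nat.card C.Gate := by
  choose g hg using fun x => (C.var_unique x).exists
  have hinj : Function.Injective g := by
    intro x y hxy
    have := (hg x).symm.trans ((congrArg C.kind hxy).trans (hg y))
    cases this
    rfl
  simpa [Nat.card_eq_fintype_card] using Nat.card_le_card_of_injective g hinj

/-- The exponent of the lower bounds. -/
noncomputable def lowerExponent (c : ℕ) : ℝ :=
  1 / (4 * c ^ 5 + c ^ 2 + 1)

theorem lowerExponent_pos (c : ℕ) : 0 < lowerExponent c := by
  rw [lowerExponent]; positivity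

theorem lower_bound_of_card [Fintype V] {c m : ℕ} (C : Circuit V)
    (htw : φ.treewidth ≤ 2 * c ^ 5 * m + c ^ 2) (hm : 2 ^ m ≤ Nat.card C.Gate + 1) :
    (2 : ℝ) ^ (lowerExponent c * (φ.treewidth : ℝ)) ≤ (C.size : ℝ) := by
  have hsize : Nat.card C.Gate ≤ C.size := Nat.le_add_right _ _
  have hcard := card_vars_le_card_gate C
  have hlt := treewidth_lt_card φ
  set k := φ.treewidth
  set s := C.size
  rcases Nat.eq_zero_or_pos k with hk | hk
  · rw [hk, Nat.cast_zero, mul_zero, Real.rpow_zero]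
    exact_mod_cast (show 1 ≤ s by omega)
  -- The gates of the variables already give `k < |V| ≤ s`.
  have hs : 2 ≤ s := by omega
  -- For small `m` the bound `2 ^ m ≤ s + 1` is too weak to absorb the additive `c ^ 2`; with `q ≥
  -- 2` it is at most `c ^ 2 * (q / 2)`. Passing from `s + 1` to `s ^ 2` halves the exponent, hence
  -- `4 * c ^ 5` in `lowerExponent`.
  set q := max 2 m
  have hpow : 2 ^ q ≤ s ^ 2 := by
    rcases le_total m 2 with h | h
    · rw [show q = 2 from max_eq_left h]
      exact Nat.pow_le_pow_left hs 2
    · rw [show q = m from max_eq_right h]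
      nlinarith
  have hkq : (k : ℝ) ≤ (4 * c ^ 5 + c ^ 2 + 1) * (q / 2) := by
    have h1 : (k : ℝ) ≤ 2 * c ^ 5 * m + c ^ 2 := by exact_mod_cast htw
    have h2 : (m : ℝ) ≤ q := by exact_mod_cast le_max_right 2 m
    have h3 : (2 : ℝ) ≤ q := by exact_mod_cast le_max_left 2 m
    have h4 : (2 : ℝ) * c ^ 5 * m ≤ 2 * c ^ 5 * q := by gcongr
    have h5 : (c : ℝ) ^ 2 * 1 ≤ c ^ 2 * (q / 2) := by gcongr; linarith
    nlinarith
  have hexp : lowerExponent c * (k : ℝ) ≤ q / 2 := by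
    rw [lowerExponent, div_mul_eq_mul_div, one_mul, div_le_iff₀ (by positivity), mul_comm]
    exact hkq
  calc (2 : ℝ) ^ (lowerExponent c * (k : ℝ)) ≤ 2 ^ ((q : ℝ) / 2) :=
        Real.rpow_le_rpow_of_exponent_le (by norm_num) hexp
    _ ≤ s := by
      refine le_of_sq_le_sq ?_ (Nat.cast_nonneg s)
      rw [← Real.rpow_natCast, ← Real.rpow_mul (by norm_num)]
      rw [show (q : ℝ) / 2 * ((2 : ℕ) : ℝ) = q by push_cast; ring, Real.rpow_natCast]
      exact_mod_cast hpow

theorem lower_bound_dnf [Fintype V] {c : ℕ} (har : φ.arity ≤ c) (hdeg : φ.degree ≤ c)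
    {C : Circuit V} (hC : C.IsDSDNNF) (hφ : C.Captures φ.DNFTrue) :
    (2 : ℝ) ^ (lowerExponent c * (φ.treewidth : ℝ)) ≤ (C.size : ℝ) := by
  classical
  obtain ⟨⟨hnnf, -, T, hT⟩, hdet⟩ := hC
  obtain ⟨n, hn, E, x, y, htw, h⟩ := exists_hard_cut har hdeg hT.1
  have := pow_le_of_rank hnnf hdet hT hn (selectVal E x) (selectVal E y)
    fun a b => (hφ _).trans (h a b)
  rw [Fintype.card_coe] at this
  exact lower_bound_of_card C htw this

theorem lower_bound_cnf [Fintype V] {c : ℕ} (har : φ.arity ≤ c) (hdeg : φ.degree ≤ c)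
    {C : Circuit V} (hC : C.IsSDNNF) (hφ : C.Captures φ.CNFTrue) :
    (2 : ℝ) ^ (lowerExponent c * (φ.treewidth : ℝ)) ≤ (C.size : ℝ) := by
  classical
  obtain ⟨hnnf, -, T, hT⟩ := hC
  obtain ⟨n, hn, E, x, y, htw, h⟩ := exists_hard_cut har hdeg hT.1
  have := pow_le_of_fooling hnnf hT hn (fun a v => !selectVal E x a v)
    (fun b v => !selectVal E y b v) fun a b => by
      rw [hφ, cnfTrue_iff_not_dnfTrue, not_glue, h, not_not]
  rw [Fintype.card_coe] at this
  exact lower_bound_of_card C htw this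

end Independent

end KnowledgeCompilation

theorem mainTheorem5 (c : ℕ) :
    (∃ (K : ℕ) (α : ℝ), 0 < α ∧
      ∀ (V : Type u) [Fintype V] (φ : KnowledgeCompilation.MonotoneFormula V),
        φ.arity ≤ c → φ.degree ≤ c →
          (∃ C : KnowledgeCompilation.Circuit V, C.IsDSDNNF ∧ C.Captures φ.DNFTrue ∧
            C.size ≤ φ.size * 2 ^ (K * (φ.treewidth + 1))) ∧
          (∀ C : KnowledgeCompilation.Circuit V, C.IsDSDNNF → C.Captures φ.DNFTrue →
            (2 : ℝ) ^ (α * (φ.treewidth : ℝ)) ≤ (C.size : ℝ))) ∧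
    (∃ (K : ℕ) (α : ℝ), 0 < α ∧
      ∀ (V : Type u) [Fintype V] (φ : KnowledgeCompilation.MonotoneFormula V),
        φ.arity ≤ c → φ.degree ≤ c →
          (∃ C : KnowledgeCompilation.Circuit V, C.IsDSDNNF ∧ C.Captures φ.CNFTrue ∧
            C.size ≤ φ.size * 2 ^ (K * (φ.treewidth + 1))) ∧
          (∀ C : KnowledgeCompilation.Circuit V, C.IsSDNNF → C.Captures φ.CNFTrue →
            (2 : ℝ) ^ (α * (φ.treewidth : ℝ)) ≤ (C.size : ℝ))) := by
  refine ⟨⟨4 * c + 9, KnowledgeCompilation.lowerExponent c,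
    KnowledgeCompilation.lowerExponent_pos c, fun V _ φ har hdeg => ⟨?_, ?_⟩⟩,
    ⟨4 * c + 9, KnowledgeCompilation.lowerExponent c,
    KnowledgeCompilation.lowerExponent_pos c, fun V _ φ har hdeg => ⟨?_, ?_⟩⟩⟩
  · exact KnowledgeCompilation.upper_bound_of_signature hdeg _
      fun A _ hM => KnowledgeCompilation.exists_signature_dnf φ A hM
  · exact fun C hC hφ => KnowledgeCompilation.lower_bound_dnf har hdeg hC hφ
  · exact KnowledgeCompilation.upper_bound_of_signature hdeg _
      fun A _ hM => KnowledgeCompilation.exists_signature_cnf φ A hM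
  · exact fun C hC hφ => KnowledgeCompilation.lower_bound_cnf har hdeg hC hφ
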